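/- **Setting.** Let $[p]=\{1,\dots,p\}$. Graphs have vertex set $[p]$ and are given by a set $E$ of ordered pairs of distinct vertices; write $a\to b$ (arrow) if $(a,b)\in E$, $(b,a)\notin E$, and $a - b$ (line) if both pairs are in $E$. Two vertices are adjacent if they are joined by an arrow or a line; $G\subset H$ means inclusion of edge sets; $G\pm(a,b)$ denotes insertion/removal of the ordered pair $(a,b)$; $\mathrm{nb}_G(v)=\{a: a - v\in G\}$; the skeleton of $G$ is the undirected graph with the same adjacencies. A DAG is a directed graph without cycles; $\mathrm{pa}_D(a)=\{b : b\to a\in D\}$. $T_G(v)$, the chain component of $v$, is the set of all $b$ such that there are paths (following edges $(a_{i-1},a_i)\in E$) in $G$ from $v$ to $b$ and from $b$ to $v$. An ordering $(v_1,\dots,v_k)$ of the vertices of a graph is a perfect elimination ordering if for each $i$ the vertices among $v_1,\dots,v_{i-1}$ adjacent to $v_i$ are pairwise adjacent. For each $i\in[p]$ let $(\mathcal X_i,\mathcal A_i,\mu_i)$ be a $\sigma$-finite measure space having two disjoint measurable sets of positive measure, and let $\mu=\bigotimes_i\mu_i$ on $\mathcal X=\prod_i\mathcal X_i$. For a strictly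 positive probability density $f$ w.r.t. $\mu$ let $f(x_a\mid x_B)=f(x_{\{a\}\cup B})/f(x_B)$ denote the conditional densities (quotients of marginal densities). For a DAG $D$ let $\mathcal M(D)$ be the set of strictly positive densities with $f(x)=\prod_{i}f(x_i\mid x_{\mathrm{pa}_D(i)})$ $\mu$-a.e. Let $\mathcal I=(I_1,\dots,I_J)$, $I_j\subset[p]$, be a conservative family of targets, i.e. for every $a\in[p]$ there is a $j$ with $a\notin I_j$. Let $D^{(I)}$ be $D$ with all edges $(a,b)$, $b\in I$, removed, and let $\mathcal M_{\mathcal I}(D)$ be the set of tuples $(f^{(j)})_{j\le J}$ with $f^{(j)}\in\mathcal M(D^{(I_j)})$ for all $j$ and $f^{(j)}(x_a\mid x_{\mathrm{pa}_D(a)})=f^{(k)}(x_a\mid x_{\mathrm{pa}_D(a)})$ $\mu$-a.e. for all $j,k$ and all $a\notin I_j\cup I_k$. DAGs $D_1,D_2$ are $\mathcal I$-equivalent if $\mathcal M_{\mathcal I}(D_1)=\mathcal M_{\mathcal I}(D_2)$. The $\mathcal I$-essential graph $\mathcal E_{\mathcal I}(D)$ is the union of all DAGs $\mathcal I$-equivalent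 to $D$. A graph $H$ is a *partial $\mathcal I$-essential graph* of a DAG $D$ if $D\subset H\subset\mathcal E_{\mathcal I}(D)$ and $H$ has no induced subgraph of the form $a\to b - c$. Let $G$ be the $\mathcal I$-essential graph of some DAG. Let $\mathbf D(G)$ be the set of DAGs $D\subset G$ with the same skeleton as $G$ such that for every chain component $T$ of $G$ the induced subgraph $D[T]$ is oriented according to a perfect elimination ordering of $G[T]$. Let $\mathbf D^+(G)$ be the set of DAGs $D'$ having an arrow $u\to v$ with $D'-(u,v)\in\mathbf D(G)$; $\mathbf D^-(G)$ the set of DAGs obtained from some $D\in\mathbf D(G)$ by removing one arrow; and $\mathbf D^{\circlearrowleft}(G)$ the set of DAGs $D'\notin\mathbf D(G)$ having an arrow $u\to v$ with $D'-(u,v)+(v,u)\in\mathbf D(G)$. **Lemma.** 1. (Forward step.) Let $u\ne v$ be non-adjacent in $G$, $D\in\mathbf D(G)$, $C=\{a\in\mathrm{nb}_G(v): a\to v\in D\}$, and suppose $D'=D+(u,v)\in\mathbf D^+(G)$. Let $H$ be obtained from $G$ by orienting all edges inside $T_G(v)$ as in $D$ (leaving everything else unchanged) and inserting $(u,v)$.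 Then $H$ is a partial $\mathcal I$-essential graph of $D'$. 2. (Backward step.) Let $(u,v)$ be an edge of $G$ (that is, $u - v\in G$ or $u\to v\in G$), $D\in\mathbf D(G)$ with $u\to v\in D$, $C=\{a\in\mathrm{nb}_G(v)\setminus\{u\}: a\to v\in D\}$, and $D'=D-(u,v)\in\mathbf D^-(G)$. Let $H$ be obtained from $G$ by orienting all edges inside $T_G(v)$ as in $D$ and removing $(u,v)$. Then $H$ is a partial $\mathcal I$-essential graph of $D'$. 3. (Turning step, line of $G$.) Let $u - v\in G$, $C\subset\mathrm{nb}_G(v)\setminus\{u\}$, $D\in\mathbf D(G)$ with $v\to u\in D$ and $\{a\in\mathrm{nb}_G(v): a\to v\in D\}=C$, and suppose $D'=D-(v,u)+(u,v)\in\mathbf D^{\circlearrowleft}(G)$. Let $H$ be obtained from $G$ by orienting all edges inside $T_G(v)$ as in $D$ and replacing $v\to u$ by $u\to v$. Then $H$ is a partial $\mathcal I$-essential graph of $D'$. 4. (Turning step, arrow of $G$.) Let $v\to u\in G$, $D\in\mathbf D(G)$, $C=\{a\in\mathrm{nb}_G(v): a\to v\in D\}$, and suppose $D'=D-(v,u)+(u,v)\in\mathbf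 D^{\circlearrowleft}(G)$. Let $H$ be obtained from $G$ by orienting all edges inside $T_G(v)$ and all edges inside $T_G(u)$ as in $D$ and replacing $v\to u$ by $u\to v$. Then $H$ is a partial $\mathcal I$-essential graph of $D'$. -/

import Mathlib

open MeasureTheory
open scoped ENNReal

namespace IntervGraph

section Graphs

variable {V : Type*}

/- A graph is given by its set of ordered pairs `(a, b)`, i.e. by a `Digraph`. All graphs that
occur below are contained in essential graphs of acyclic graphs, so they have no loops. -/

/-- `a → b ∈ G`: the edge is present in this direction only. -/
def IsArrow (G : Digraph V) (a b : V) : Prop := G.Adj a b ∧ ¬ G.Adj b a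

/-- `a — b ∈ G`: the edge is present in both directions. -/
def IsLine (G : Digraph V) (a b : V) : Prop := G.Adj a b ∧ G.Adj b a

/-- `a` and `b` are joined by an edge of some kind. -/
def IsAdjacent (G : Digraph V) (a b : V) : Prop := G.Adj a b ∨ G.Adj b a

/-- The skeleton `G^u`. -/
def skeleton (G : Digraph V) : Digraph V where
  Adj a b := IsAdjacent G a b

/-- The neighbors of `a`, i.e. the vertices joined to `a` by a line. -/
def nb (G : Digraph V) (a : V) : Set V := {b | IsLine G a b}

/-- The induced subgraph `G[T]`. -/
def induced (G : Digraph V) (T : Set V) : Digraph T where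
  Adj a b := G.Adj a b

/-- `G + (a, b)`. -/
def addEdge (G : Digraph V) (a b : V) : Digraph V where
  Adj x y := G.Adj x y ∨ (x = a ∧ y = b)

/-- `G - (a, b)`. -/
def removeEdge (G : Digraph V) (a b : V) : Digraph V where
  Adj x y := G.Adj x y ∧ ¬ (x = a ∧ y = b)

/-- A directed acyclic graph: no vertex can be reached from itself by a nonempty sequence of
edges. (A loop or a line would be such a sequence, so all edges of `D` are arrows.) -/
def IsDAG (D : Digraph V) : Prop := ∀ a, ¬ Relation.TransGen D.Adj a a

/-- The preorder `a ≼ b`: there is a path (of length at least `0`) from `a` to `b`. -/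
def Precedes (G : Digraph V) (a b : V) : Prop := Relation.ReflTransGen G.Adj a b

/-- The chain component `T_G(a)`, the class of `a` for `a ≼ b ∧ b ≼ a`. -/
def chainComponent (G : Digraph V) (a : V) : Set V := {b | Precedes G a b ∧ Precedes G b a}

/-- The ordering `σ` is a perfect elimination ordering of `G`: the vertices that precede `σ i`
and are adjacent to it in the skeleton of `G` are pairwise adjacent. -/
def IsPerfectEliminationOrdering (G : Digraph V) (σ : Fin (Nat.card V) ≃ V) : Prop :=
  ∀ i j k, j < i → k < i → j ≠ k → IsAdjacent G (σ j) (σ i) → IsAdjacent G (σ k) (σ i) →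
    IsAdjacent G (σ j) (σ k)

/-- `D` is oriented according to the ordering `σ`. -/
def IsOrientedAccordingTo (D : Digraph V) (σ : Fin (Nat.card V) ≃ V) : Prop :=
  ∀ a b, D.Adj a b → σ.symm a < σ.symm b

/-- The set `𝐃(G)` of representatives of an essential graph `G`. -/
def representatives (G : Digraph V) : Set (Digraph V) :=
  {D | IsDAG D ∧ D ≤ G ∧ skeleton D = skeleton G ∧
    ∀ a : V, ∃ σ : Fin (Nat.card (chainComponent G a)) ≃ chainComponent G a,
      IsPerfectEliminationOrdering (induced G (chainComponent G a)) σ ∧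
      IsOrientedAccordingTo (induced D (chainComponent G a)) σ}

/-- `𝐃⁺(G)`: the DAGs from which a representative arises by removing one arrow. -/
def forwardDAGs (G : Digraph V) : Set (Digraph V) :=
  {D' | IsDAG D' ∧ ∃ u v, IsArrow D' u v ∧ removeEdge D' u v ∈ representatives G}

/-- `𝐃⁻(G)`: the DAGs obtained by removing one arrow of a representative. -/
def backwardDAGs (G : Digraph V) : Set (Digraph V) :=
  {D' | IsDAG D' ∧ ∃ D ∈ representatives G, ∃ u v, IsArrow D u v ∧ D' = removeEdge D u v}

/-- `𝐃^↺(G)`: the DAGs that are not representatives, but become one by turning one arrow. -/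
def turningDAGs (G : Digraph V) : Set (Digraph V) :=
  {D' | IsDAG D' ∧ D' ∉ representatives G ∧
    ∃ u v, IsArrow D' u v ∧ addEdge (removeEdge D' u v) v u ∈ representatives G}

/-- The graph obtained from `G` by orienting all edges inside `T` as in `D`. -/
def orientAs (G D : Digraph V) (T : Set V) : Digraph V where
  Adj a b := (a ∈ T ∧ b ∈ T ∧ D.Adj a b) ∨ (¬ (a ∈ T ∧ b ∈ T) ∧ G.Adj a b)

/-- The intervention graph `D^(I)`. -/
def interventionGraph (D : Digraph V) (I : Finset V) : Digraph V where
  Adj a b := D.Adj a b ∧ b ∉ I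

/-- A family of targets is conservative if every vertex is avoided by some target. -/
def IsConservative {ι : Type*} (𝓘 : ι → Finset V) : Prop := ∀ a, ∃ j, a ∉ 𝓘 j

open Classical in
/-- The set of parents of `a`. -/
noncomputable def pa [Fintype V] (G : Digraph V) (a : V) : Finset V :=
  Finset.univ.filter fun b => IsArrow G b a

end Graphs

section Densities

variable {V : Type*} [Fintype V] [DecidableEq V] {Ω : V → Type*} [∀ i, MeasurableSpace (Ω i)]
  (μ : ∀ i, Measure (Ω i))

/-- Strictly positive probability densities on `∏ i, Ω i` with respect to the product measure. -/
def IsPositiveDensity (f : (∀ i, Ω i) → ℝ≥0∞) : Prop :=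
  Measurable f ∧ (∀ x, 0 < f x ∧ f x < ∞) ∧ ∫⁻ x, f x ∂(Measure.pi μ) = 1

/-- The marginal density `f(x_A)`; all variables outside `A` are integrated out. -/
noncomputable def marginalDensity (f : (∀ i, Ω i) → ℝ≥0∞) (A : Finset V) : (∀ i, Ω i) → ℝ≥0∞ :=
  ∫⋯∫⁻_Aᶜ, f ∂μ

/-- The conditional density `f(x_a | x_B)`. -/
noncomputable def condDensity (f : (∀ i, Ω i) → ℝ≥0∞) (a : V) (B : Finset V) (x : ∀ i, Ω i) :
    ℝ≥0∞ :=
  marginalDensity μ f (insert a B) x / marginalDensity μ f B x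

/-- `𝓜(D)`: the positive densities that obey the Markov property of `D`. -/
def markovDensities (D : Digraph V) : Set ((∀ i, Ω i) → ℝ≥0∞) :=
  {f | IsPositiveDensity μ f ∧
    f =ᵐ[Measure.pi μ] fun x => ∏ i, condDensity μ f i (pa D i) x}

/-- `𝓜_𝓘(D)`: the tuples of interventional densities, indexed by the family of targets `𝓘`. -/
def interventionalDensities {ι : Type*} (𝓘 : ι → Finset V) (D : Digraph V) :
    Set (ι → (∀ i, Ω i) → ℝ≥0∞) :=
  {f | (∀ j, f j ∈ markovDensities μ (interventionGraph D (𝓘 j))) ∧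
    ∀ j k a, a ∉ 𝓘 j → a ∉ 𝓘 k →
      condDensity μ (f j) a (pa D a) =ᵐ[Measure.pi μ] condDensity μ (f k) a (pa D a)}

/-- Interventional Markov equivalence `D₁ ∼_𝓘 D₂`. -/
def MarkovEquivalent {ι : Type*} (𝓘 : ι → Finset V) (D₁ D₂ : Digraph V) : Prop :=
  interventionalDensities μ 𝓘 D₁ = interventionalDensities μ 𝓘 D₂

/-- The `𝓘`-essential graph of `D`: the union of all DAGs equivalent to `D`. -/
def essentialGraph {ι : Type*} (𝓘 : ι → Finset V) (D : Digraph V) : Digraph V :=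
  sSup {D' | IsDAG D' ∧ MarkovEquivalent μ 𝓘 D' D}

/-- `G` is the `𝓘`-essential graph of some DAG. -/
def IsEssentialGraph {ι : Type*} (𝓘 : ι → Finset V) (G : Digraph V) : Prop :=
  ∃ D, IsDAG D ∧ G = essentialGraph μ 𝓘 D

/-- `G` is a partial `𝓘`-essential graph of the DAG `D`: it lies between `D` and the essential
graph of `D` and has no induced subgraph `a → b — c`. -/
def IsPartialEssentialGraph {ι : Type*} (𝓘 : ι → Finset V) (D G : Digraph V) : Prop :=
  IsDAG D ∧ D ≤ G ∧ G ≤ essentialGraph μ 𝓘 D ∧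
    ¬ ∃ a b c, IsArrow G a b ∧ IsLine G b c ∧ ¬ IsAdjacent G a c

end Densities

end IntervGraph

open IntervGraph

/-! Equivalence of DAGs is first made combinatorial: `MarkovEquivalent` amounts to `GraphEquivalent`
(same skeleton, same v-structures, and targets that do not separate the ends of a differently
oriented edge). Necessity (`graphEquivalent_of_markovEquivalent`) tests with `parityDensity`, whose
only dependence is a joint one among a chosen set of variables. Sufficiency
(`markovEquivalent_of_graphEquivalent`) joins two DAGs by reversals of covered edges, each
preserving the interventional densities by the chain rule.

The essential graph `G` is then the union of a class of DAGs, and every representative lies in this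
class (`of_mem_representatives`). Members of the class can be spliced along chain components
(`IsEssentialFor.orientAs`). An edge of `H` that is missing in `D'` is an edge of `G` outside the
oriented components. Some member `E` contains it and has the same edges as `D` into those components
(`exists_reorientation`). The same addition, removal or turning applied to `E` gives a graph that is
equivalent to `D'` and contains the edge.

In the forward and turning steps the new graph must also be acyclic. A path in `E` can be rearranged
into lines of `G` followed by arrows of `G` (`exists_lines_arrows`). The lines stay in a component
where `E` agrees with `D`, and the arrows belong to every member, so a cycle would already occur in
`D'`.

Finally, the lines of `H` avoid the oriented components, so an induced `a → b — c` in `H` would come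
from one in `G`. Only the removal of an edge, which can destroy an adjacency, needs an extra
argument. -/

namespace IntervGraph

/-! ### Almost everywhere properties of marginals. -/

section Marginals

variable {V : Type*} [DecidableEq V] {Ω : V → Type*} [∀ i, MeasurableSpace (Ω i)]
  {μ : ∀ i, Measure (Ω i)}

theorem lmarginal_pos (hμ : ∀ i, μ i ≠ 0) {f : (∀ i, Ω i) → ℝ≥0∞} (hf : Measurable f)
    (hpos : ∀ x, 0 < f x) [∀ i, SigmaFinite (μ i)] (s : Finset V) (x : ∀ i, Ω i) :
    0 < (∫⋯∫⁻_s, f ∂μ) x := by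
  unfold lmarginal
  have hm : Measurable fun y : ∀ i : s, Ω i => f (Function.updateFinset x s y) :=
    hf.comp measurable_updateFinset
  rw [lintegral_pos_iff_support hm]
  have h : Function.support (fun y : ∀ i : s, Ω i => f (Function.updateFinset x s y)) = Set.univ :=
    Set.eq_univ_of_forall fun y => (hpos _).ne'
  rw [h, Measure.pi_univ, pos_iff_ne_zero, Finset.prod_ne_zero_iff]
  exact fun i _ => by simpa using hμ i

variable [Fintype V] [∀ i, SigmaFinite (μ i)]

theorem lmarginal_compl (f : (∀ i, Ω i) → ℝ≥0∞) (hf : Measurable f) (s : Finset V) :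
    ∫⋯∫⁻_sᶜ, ∫⋯∫⁻_s, f ∂μ ∂μ = fun _ => ∫⁻ x, f x ∂Measure.pi μ := by
  rw [← lmarginal_union μ f hf disjoint_compl_left, Finset.union_comm, Finset.union_compl,
    lmarginal_univ]

theorem lintegral_eq_zero_of_lmarginal {f : (∀ i, Ω i) → ℝ≥0∞} (hf : Measurable f) (s : Finset V)
    (h : ∀ x, (∫⋯∫⁻_s, f ∂μ) x = 0) : ∫⁻ x, f x ∂Measure.pi μ = 0 := by
  -- Tonelli is available as an equality of functions, so a point is needed at which to evaluate it.
  rcases isEmpty_or_nonempty (∀ i, Ω i) with _ | ⟨⟨x⟩⟩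
  · simp
  have h1 := congrFun (lmarginal_compl (μ := μ) f hf s) x
  rw [← h1, show ∫⋯∫⁻_s, f ∂μ = fun _ => 0 from funext h]
  simp [lmarginal]

theorem lmarginal_eq_zero_ae {f : (∀ i, Ω i) → ℝ≥0∞} (hf : Measurable f) (s : Finset V)
    (h : ∫⁻ x, f x ∂Measure.pi μ = 0) : ∀ᵐ x ∂Measure.pi μ, (∫⋯∫⁻_s, f ∂μ) x = 0 := by
  refine (lintegral_eq_zero_iff (hf.lmarginal μ)).1 ?_
  refine lintegral_eq_zero_of_lmarginal (hf.lmarginal μ) sᶜ fun x => ?_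
  rw [lmarginal_compl f hf, h]

/-- The set where `f` and `g` differ is null, so by Tonelli almost every fibre meets it in a null
set. -/
theorem lmarginal_ae_congr {f g : (∀ i, Ω i) → ℝ≥0∞} (hf : Measurable f) (hg : Measurable g)
    (s : Finset V) (h : f =ᵐ[Measure.pi μ] g) :
    ∫⋯∫⁻_s, f ∂μ =ᵐ[Measure.pi μ] ∫⋯∫⁻_s, g ∂μ := by
  have hN : MeasurableSet {x | f x ≠ g x} := (measurableSet_eq_fun hf hg).compl
  have hI : Measurable ({x | f x ≠ g x}.indicator (1 : (∀ i, Ω i) → ℝ≥0∞)) :=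
    measurable_one.indicator hN
  have h0 : ∫⁻ x, {x | f x ≠ g x}.indicator (1 : (∀ i, Ω i) → ℝ≥0∞) x ∂Measure.pi μ = 0 := by
    rw [lintegral_indicator_one hN]
    exact ae_iff.1 h
  filter_upwards [lmarginal_eq_zero_ae hI s h0] with x hx
  replace hx := (lintegral_eq_zero_iff (hI.comp measurable_updateFinset)).1 hx
  refine lintegral_congr_ae ?_
  filter_upwards [hx] with y hy
  by_contra hne
  simp [Set.indicator, hne] at hy

theorem lmarginal_lt_top_ae {f : (∀ i, Ω i) → ℝ≥0∞} (hf : Measurable f) (s : Finset V)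
    (h : ∫⁻ x, f x ∂Measure.pi μ ≠ ∞) : ∀ᵐ x ∂Measure.pi μ, (∫⋯∫⁻_s, f ∂μ) x < ∞ := by
  have hm : Measurable (∫⋯∫⁻_s, f ∂μ) := hf.lmarginal μ
  have hN : MeasurableSet {x | ¬ (∫⋯∫⁻_s, f ∂μ) x < ∞} :=
    (measurableSet_lt hm measurable_const).compl
  have hI : Measurable ({x | ¬ (∫⋯∫⁻_s, f ∂μ) x < ∞}.indicator (1 : (∀ i, Ω i) → ℝ≥0∞)) :=
    measurable_one.indicator hN
  rw [ae_iff, ← lintegral_indicator_one hN]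
  refine lintegral_eq_zero_of_lmarginal hI sᶜ fun x => ?_
  have h1 := congrFun (lmarginal_compl (μ := μ) f hf s) x
  refine (lintegral_eq_zero_iff (hI.comp measurable_updateFinset)).2 ?_
  have h2 := ae_lt_top ((hf.lmarginal μ (s := s)).comp
    (measurable_updateFinset (x := x) (s := sᶜ))) (by
      refine ne_of_eq_of_ne ?_ h
      exact h1)
  filter_upwards [h2] with y hy
  simp only [Function.comp_def] at hy
  simp [Set.indicator, hy.ne]

end Marginals

/-! ### Parents in intervention graphs. -/

section Parents

variable {V : Type*}

theorem IsDAG.interventionGraph {D : Digraph V} (hD : IsDAG D) (I : Finset V) :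
    IsDAG (interventionGraph D I) :=
  fun a h => hD a (Relation.TransGen.mono (fun _ _ h => h.1) a a h)

variable [Fintype V]

theorem mem_pa_iff {D : Digraph V} (hD : IsDAG D) {a b : V} : b ∈ pa D a ↔ D.Adj b a := by
  classical
  rw [pa, Finset.mem_filter]
  exact ⟨fun h => h.2.1, fun h => ⟨Finset.mem_univ _, h, fun h' => hD a (.trans (.single h') (.single h))⟩⟩

theorem notMem_pa {D : Digraph V} (a : V) : a ∉ pa D a := by
  classical
  rw [pa, Finset.mem_filter]
  exact fun h => h.2.2 h.2.1

theorem pa_interventionGraph [DecidableEq V] {D : Digraph V} (hD : IsDAG D) (I : Finset V) (a : V) :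
    pa (interventionGraph D I) a = if a ∈ I then ∅ else pa D a := by
  ext b
  rw [mem_pa_iff (hD.interventionGraph I)]
  split_ifs with h
  · simp [interventionGraph, h]
  · simp [interventionGraph, h, mem_pa_iff hD]

end Parents

/-! ### Reversal of a covered edge preserves interventional densities. -/

section CoveredEdges

variable {V : Type*} [Fintype V] [DecidableEq V] {Ω : V → Type*} [∀ i, MeasurableSpace (Ω i)]
  {μ : ∀ i, Measure (Ω i)}

/-- The conditional density `f(x_a, x_b | x_B)`. -/
noncomputable def condDensityPair (μ : ∀ i, Measure (Ω i)) (f : (∀ i, Ω i) → ℝ≥0∞) (a b : V)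
    (B : Finset V) (x : ∀ i, Ω i) : ℝ≥0∞ :=
  marginalDensity μ f (insert a (insert b B)) x / marginalDensity μ f B x

theorem condDensityPair_comm (f : (∀ i, Ω i) → ℝ≥0∞) (a b : V) (B : Finset V) :
    condDensityPair μ f a b B = condDensityPair μ f b a B := by
  unfold condDensityPair
  rw [Finset.insert_comm]

variable [∀ i, SigmaFinite (μ i)]

theorem marginalDensity_pos_lt_top (hμ : ∀ i, μ i ≠ 0) {f : (∀ i, Ω i) → ℝ≥0∞}
    (hf : IsPositiveDensity μ f) (A : Finset V) :
    ∀ᵐ x ∂Measure.pi μ, marginalDensity μ f A x ≠ 0 ∧ marginalDensity μ f A x ≠ ∞ := by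
  filter_upwards [lmarginal_lt_top_ae hf.1 Aᶜ (by simp [hf.2.2])] with x hx
  exact ⟨(lmarginal_pos hμ hf.1 (fun x => (hf.2.1 x).1) _ x).ne', hx.ne⟩

theorem condDensity_mul (hμ : ∀ i, μ i ≠ 0) {f : (∀ i, Ω i) → ℝ≥0∞}
    (hf : IsPositiveDensity μ f) (a b : V) (B : Finset V) :
    ∀ᵐ x ∂Measure.pi μ, condDensity μ f a B x * condDensity μ f b (insert a B) x =
      condDensityPair μ f a b B x := by
  filter_upwards [marginalDensity_pos_lt_top hμ hf (insert a B)] with x hx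
  unfold condDensity condDensityPair
  rw [Finset.insert_comm a b, div_eq_mul_inv, div_eq_mul_inv, div_eq_mul_inv]
  calc _ = (marginalDensity μ f (insert a B) x * (marginalDensity μ f (insert a B) x)⁻¹) *
        (marginalDensity μ f (insert b (insert a B)) x * (marginalDensity μ f B x)⁻¹) := by ring
    _ = _ := by rw [ENNReal.mul_inv_cancel hx.1 hx.2, one_mul]

theorem measurable_marginalDensity {f : (∀ i, Ω i) → ℝ≥0∞} (hf : Measurable f) (A : Finset V) :
    Measurable (marginalDensity μ f A) := hf.lmarginal μ

/-- The denominator does not depend on `x_a`, so it leaves the integral. -/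
theorem lmarginal_condDensityPair {f : (∀ i, Ω i) → ℝ≥0∞} (hf : Measurable f) {a b : V}
    (hab : a ≠ b) {B : Finset V} (ha : a ∉ B) :
    ∫⋯∫⁻_{a}, condDensityPair μ f a b B ∂μ = condDensity μ f b B := by
  have hsplit : marginalDensity μ f (insert b B) =
      ∫⋯∫⁻_{a}, marginalDensity μ f (insert a (insert b B)) ∂μ := by
    unfold marginalDensity
    rw [← lmarginal_union μ f hf (by simp)]
    congr 1
    ext i
    by_cases hi : i = a
    · subst hi; simp [hab, ha]
    · simp [hi]
  funext x
  unfold condDensity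
  rw [hsplit, lmarginal_singleton, lmarginal_singleton]
  simp only [condDensityPair, div_eq_mul_inv]
  have hc : ∀ y, marginalDensity μ f B (Function.update x a y) = marginalDensity μ f B x :=
    fun y => lmarginal_update_of_mem μ (by simpa using ha) f x y
  simp only [hc]
  rw [lintegral_mul_const]
  exact (measurable_marginalDensity hf _).comp (measurable_update x)

/-- The two given factors determine `f(x_a, x_b | x_B)` by the chain rule. Integrating out `x_a`
gives the first new factor, and division, legitimate almost everywhere by positivity and finiteness,
gives the second. -/
theorem condDensity_covered_congr (hμ : ∀ i, μ i ≠ 0) {f g : (∀ i, Ω i) → ℝ≥0∞}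
    (hf : IsPositiveDensity μ f) (hg : IsPositiveDensity μ g) {a b : V} (hab : a ≠ b)
    {B : Finset V} (ha : a ∉ B)
    (h1 : condDensity μ f a B =ᵐ[Measure.pi μ] condDensity μ g a B)
    (h2 : condDensity μ f b (insert a B) =ᵐ[Measure.pi μ] condDensity μ g b (insert a B)) :
    condDensity μ f b B =ᵐ[Measure.pi μ] condDensity μ g b B ∧
      condDensity μ f a (insert b B) =ᵐ[Measure.pi μ] condDensity μ g a (insert b B) := by
  have hq : condDensityPair μ f a b B =ᵐ[Measure.pi μ] condDensityPair μ g a b B := by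
    filter_upwards [h1, h2, condDensity_mul hμ hf a b B, condDensity_mul hμ hg a b B]
      with x e1 e2 e3 e4
    rw [← e3, ← e4, e1, e2]
  have hmeas : ∀ {f : (∀ i, Ω i) → ℝ≥0∞}, Measurable f → Measurable (condDensityPair μ f a b B) :=
    fun hf => (measurable_marginalDensity hf _).div (measurable_marginalDensity hf _)
  have h3 : condDensity μ f b B =ᵐ[Measure.pi μ] condDensity μ g b B := by
    have := lmarginal_ae_congr (hmeas hf.1) (hmeas hg.1) {a} hq
    rwa [lmarginal_condDensityPair hf.1 hab ha, lmarginal_condDensityPair hg.1 hab ha] at this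
  refine ⟨h3, ?_⟩
  filter_upwards [hq, h3, condDensity_mul hμ hf b a B, condDensity_mul hμ hg b a B,
    marginalDensity_pos_lt_top hμ hf B, marginalDensity_pos_lt_top hμ hf (insert b B)]
    with x e1 e2 e3 e4 e5 e6
  have h0 : condDensity μ f b B x ≠ 0 := ENNReal.div_ne_zero.2 ⟨e6.1, e5.2⟩
  have ht : condDensity μ f b B x ≠ ∞ := ENNReal.div_ne_top e6.2 e5.1
  rw [condDensityPair_comm f a b, condDensityPair_comm g a b, ← e3, ← e4, ← e2] at e1
  exact (ENNReal.mul_right_inj h0 ht).1 e1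

/-- Reversing a covered edge whose end points lie in the same targets does not change the
interventional densities. -/
theorem interventionalDensities_subset_of_covered (hμ : ∀ i, μ i ≠ 0) {ι : Type*}
    {𝓘 : ι → Finset V} {D D' : Digraph V} (hD : IsDAG D) (hD' : IsDAG D') {a b : V} (hab : a ≠ b)
    {B : Finset V} (ha : a ∉ B)
    (hDa : pa D a = B) (hDb : pa D b = insert a B) (hDa' : pa D' a = insert b B)
    (hDb' : pa D' b = B) (hrest : ∀ c, c ≠ a → c ≠ b → pa D' c = pa D c)
    (hI : ∀ j, a ∈ 𝓘 j ↔ b ∈ 𝓘 j) :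
    interventionalDensities μ 𝓘 D ⊆ interventionalDensities μ 𝓘 D' := by
  rintro f ⟨hM, hinv⟩
  refine ⟨fun j => ⟨(hM j).1, ?_⟩, fun j k c hcj hck => ?_⟩
  · have hprod : ∀ᵐ x ∂Measure.pi μ,
        ∏ i, condDensity μ (f j) i (pa (interventionGraph D (𝓘 j)) i) x =
          ∏ i, condDensity μ (f j) i (pa (interventionGraph D' (𝓘 j)) i) x := by
      filter_upwards [condDensity_mul hμ (hM j).1 a b B, condDensity_mul hμ (hM j).1 b a B]
        with x e1 e2
      simp only [pa_interventionGraph hD, pa_interventionGraph hD']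
      have hsub : ∀ F : V → ℝ≥0∞, ∏ i, F i = F a * F b * ∏ i ∈ {a, b}ᶜ, F i := fun F => by
        rw [← Finset.prod_mul_prod_compl {a, b}, Finset.prod_pair hab]
      rw [hsub, hsub (fun i => condDensity μ (f j) i (if i ∈ 𝓘 j then ∅ else pa D' i) x)]
      congr 1
      · by_cases h : a ∈ 𝓘 j
        · simp [h, (hI j).1 h]
        · have h' : b ∉ 𝓘 j := fun h' => h ((hI j).2 h')
          simp only [h, h', if_false, hDa, hDb, hDa', hDb']
          rw [e1, mul_comm, e2, condDensityPair_comm]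
      · refine Finset.prod_congr rfl fun i hi => ?_
        simp only [Finset.mem_compl, Finset.mem_insert, Finset.mem_singleton, not_or] at hi
        rw [hrest i hi.1 hi.2]
    filter_upwards [(hM j).2, hprod] with x e1 e2
    rw [e1, e2]
  -- Each new conditional density mixes both old ones, so invariance is needed at `a` and `b`
  -- together. This is where the targets must not separate them.
  · have key : a ∉ 𝓘 j → a ∉ 𝓘 k → _ := fun hj hk =>
      condDensity_covered_congr hμ (hM j).1 (hM k).1 hab ha
        (by simpa only [hDa] using hinv j k a hj hk)
        (by simpa only [hDb] using hinv j k b (fun h => hj ((hI j).2 h)) fun h => hk ((hI k).2 h))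
    by_cases hca : c = a
    · subst hca
      rw [hDa']
      exact (key hcj hck).2
    by_cases hcb : c = b
    · subst hcb
      rw [hDb']
      exact (key (fun h => hcj ((hI j).1 h)) fun h => hck ((hI k).1 h)).1
    · rw [hrest c hca hcb]
      exact hinv j k c hcj hck

end CoveredEdges

/-! ### Mean-zero perturbations of a one-dimensional density. -/

section Perturbation

/-- `g` is a positive probability density, `s` is bounded by `1`, not almost everywhere zero, and
has mean `0` under `g`, so that `g * (1 + r * s)` is a probability density for small `r`. -/
structure IsPerturbation {α : Type*} [MeasurableSpace α] (μ : Measure α) (g : α → ℝ≥0∞)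
    (s : α → ℝ) : Prop where
  measurable_density : Measurable g
  measurable_sign : Measurable s
  ne_zero : ∀ x, g x ≠ 0
  ne_top : ∀ x, g x ≠ ∞
  abs_le : ∀ x, |s x| ≤ 1
  lintegral_mul : ∀ r : ℝ, |r| ≤ 1 / 2 → ∫⁻ x, g x * ENNReal.ofReal (1 + r * s x) ∂μ = 1
  measure_support : μ {x | s x ≠ 0} ≠ 0

/-- Normalize a positive integrable function to `g`, let `ν` have density `g`, and take `s = ν(B)
1_A - ν(A) 1_B`. The two terms have equal means, and `s` is nonzero on `A` because `A` and `B` are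
disjoint. -/
theorem exists_isPerturbation {α : Type*} [MeasurableSpace α] (μ : Measure α) [SigmaFinite μ]
    (h : ∃ A B : Set α, MeasurableSet A ∧ MeasurableSet B ∧ Disjoint A B ∧ 0 < μ A ∧ 0 < μ B) :
    ∃ g s, IsPerturbation μ g s := by
  obtain ⟨A, B, hA, hB, hAB, hA0, hB0⟩ := h
  obtain ⟨g₀, hg₀, hg₀m, hg₀i⟩ := exists_pos_lintegral_lt_of_sigmaFinite μ one_ne_zero
  set c := ∫⁻ x, (g₀ x : ℝ≥0∞) ∂μ with hc
  have hmeas₀ : Measurable fun x => (g₀ x : ℝ≥0∞) := hg₀m.coe_nnreal_ennreal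
  have hc_top : c ≠ ∞ := (hg₀i.trans ENNReal.one_lt_top).ne
  have hc0 : c ≠ 0 := by
    rw [← pos_iff_ne_zero, hc, lintegral_pos_iff_support hmeas₀]
    refine hA0.trans_le (measure_mono fun x _ => ?_)
    simpa using (hg₀ x).ne'
  set g : α → ℝ≥0∞ := fun x => g₀ x * c⁻¹ with hg
  have hgm : Measurable g := hmeas₀.mul_const _
  have hg0 : ∀ x, g x ≠ 0 := fun x => mul_ne_zero (by simpa using (hg₀ x).ne') (by simpa using hc_top)
  have hgt : ∀ x, g x ≠ ∞ := fun x => ENNReal.mul_ne_top ENNReal.coe_ne_top (by simpa using hc0)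
  have hgi : ∫⁻ x, g x ∂μ = 1 := by
    rw [hg, lintegral_mul_const _ hmeas₀, ← hc, ENNReal.mul_inv_cancel hc0 hc_top]
  set ν := μ.withDensity g with hν
  have : IsProbabilityMeasure ν := ⟨by rw [hν, withDensity_apply _ .univ]; simpa using hgi⟩
  have hac : μ ≪ ν := withDensity_absolutelyContinuous' hgm.aemeasurable (ae_of_all _ hg0)
  have hpos : ∀ C : Set α, 0 < μ C → 0 < ν.real C := fun C hC => by
    refine ENNReal.toReal_pos (fun h => hC.ne' (hac h)) (measure_ne_top _ _)
  set s : α → ℝ := fun x => A.indicator (fun _ => ν.real B) x - B.indicator (fun _ => ν.real A) x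
    with hs
  have hsm : Measurable s := (measurable_const.indicator hA).sub (measurable_const.indicator hB)
  have hsb : ∀ x, |s x| ≤ 1 := by
    intro x
    have h1 := measureReal_le_one (μ := ν) (s := A)
    have h2 := measureReal_le_one (μ := ν) (s := B)
    have h3 := measureReal_nonneg (μ := ν) (s := A)
    have h4 := measureReal_nonneg (μ := ν) (s := B)
    rw [abs_le]
    by_cases hxA : x ∈ A <;> by_cases hxB : x ∈ B <;> simp [hs, hxA, hxB] <;>
      first | linarith | constructor <;> linarith
  have hsint : Integrable s ν := (integrable_const (1 : ℝ)).mono' hsm.aestronglyMeasurable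
    (ae_of_all _ fun x => by simpa using hsb x)
  have hs0 : ∫ x, s x ∂ν = 0 := by
    rw [hs, integral_sub ((integrable_const _).indicator hA) ((integrable_const _).indicator hB),
      integral_indicator_const _ hA, integral_indicator_const _ hB]
    simp [mul_comm]
  refine ⟨g, s, hgm, hsm, hg0, hgt, hsb, fun r hr => ?_, ?_⟩
  · have hm : Measurable fun x => ENNReal.ofReal (1 + r * s x) := by fun_prop
    have h1 : ∫⁻ x, ENNReal.ofReal (1 + r * s x) ∂ν = ∫⁻ x, g x * ENNReal.ofReal (1 + r * s x) ∂μ :=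
      lintegral_withDensity_eq_lintegral_mul _ hgm hm
    rw [← h1, ← ofReal_integral_eq_lintegral_ofReal]
    · rw [integral_add (integrable_const _) (hsint.const_mul _), integral_const_mul, hs0]
      simp
    · exact (integrable_const _).add (hsint.const_mul _)
    · refine ae_of_all _ fun x => ?_
      have h2 : |r * s x| ≤ 1 := by
        rw [abs_mul]
        nlinarith [hsb x, abs_nonneg r, abs_nonneg (s x)]
      have := (abs_le.1 h2).1
      simp only [Pi.zero_apply]
      linarith
  · refine (hA0.trans_le (measure_mono fun x hx => ?_)).ne'
    have hxB : x ∉ B := fun h => Set.disjoint_left.1 hAB hx h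
    simpa [hs, hx, hxB] using (hpos B hB0).ne'

end Perturbation

/-! ### Densities with a single joint dependence. -/

section ParityDensity

variable {V : Type*} {Ω : V → Type*}

/-- The factor by which `parityDensity` differs from a product density. -/
noncomputable def parityWeight (s : ∀ i, Ω i → ℝ) (S : Finset V) (t : ℝ) (x : ∀ i, Ω i) : ℝ≥0∞ :=
  ENNReal.ofReal (1 + t * ∏ i ∈ S, s i (x i))

/-- A density for which the variables in `S` are dependent, but those in any proper subset
of `S` are independent. -/
noncomputable def parityDensity [Fintype V] (g : ∀ i, Ω i → ℝ≥0∞) (s : ∀ i, Ω i → ℝ)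
    (S : Finset V) (t : ℝ) (x : ∀ i, Ω i) : ℝ≥0∞ :=
  (∏ i, g i (x i)) * parityWeight s S t x

variable [∀ i, MeasurableSpace (Ω i)] {μ : ∀ i, Measure (Ω i)} {g : ∀ i, Ω i → ℝ≥0∞}
  {s : ∀ i, Ω i → ℝ}

theorem abs_mul_prod_le (hs : ∀ i, IsPerturbation (μ i) (g i) (s i)) {t : ℝ} (ht : |t| ≤ 1 / 2)
    (S : Finset V) (x : ∀ i, Ω i) : |t * ∏ i ∈ S, s i (x i)| ≤ 1 / 2 := by
  have h : |∏ i ∈ S, s i (x i)| ≤ 1 := by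
    rw [Finset.abs_prod]
    exact Finset.prod_le_one (fun _ _ => abs_nonneg _) fun i _ => (hs i).abs_le _
  rw [abs_mul]
  nlinarith [abs_nonneg t, abs_nonneg (∏ i ∈ S, s i (x i))]

theorem parityWeight_ne_zero (hs : ∀ i, IsPerturbation (μ i) (g i) (s i)) {t : ℝ}
    (ht : |t| ≤ 1 / 2) (S : Finset V) (x : ∀ i, Ω i) : parityWeight s S t x ≠ 0 := by
  have := (abs_le.1 (abs_mul_prod_le hs ht S x)).1
  rw [parityWeight, Ne, ENNReal.ofReal_eq_zero, not_le]
  linarith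

variable [Fintype V]

theorem measurable_parityDensity (hs : ∀ i, IsPerturbation (μ i) (g i) (s i)) (S : Finset V)
    (t : ℝ) : Measurable (parityDensity g s S t) := by
  have h1 : ∀ i, Measurable fun x : ∀ i, Ω i => g i (x i) :=
    fun i => (hs i).measurable_density.comp (measurable_pi_apply i)
  have h2 : ∀ i, Measurable fun x : ∀ i, Ω i => s i (x i) :=
    fun i => (hs i).measurable_sign.comp (measurable_pi_apply i)
  exact (Finset.measurable_fun_prod _ fun i _ => h1 i).mul
    (((Finset.measurable_fun_prod _ fun i _ => h2 i).const_mul t).const_add 1).ennreal_ofReal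

variable [∀ i, SigmaFinite (μ i)]

/-- The weight differs from `1` on the box where no `s i` vanishes, and this box has positive
measure. -/
theorem not_parityWeight_ae_eq_one (hs : ∀ i, IsPerturbation (μ i) (g i) (s i)) {t : ℝ}
    (ht : t ≠ 0) (S : Finset V) :
    ¬ ∀ᵐ x ∂Measure.pi μ, parityWeight s S t x = 1 := by
  intro h
  have hsub : Set.univ.pi (fun i => {y | s i y ≠ 0}) ⊆ {x | ¬ parityWeight s S t x = 1} := by
    intro x hx heq
    have hp : ∏ i ∈ S, s i (x i) ≠ 0 := Finset.prod_ne_zero_iff.2 fun i _ => hx i trivial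
    rw [parityWeight, ENNReal.ofReal_eq_one] at heq
    exact mul_ne_zero ht hp (by linarith)
  have h0 := measure_mono_null hsub (ae_iff.1 h)
  rw [Measure.pi_pi, Finset.prod_eq_zero_iff] at h0
  obtain ⟨i, -, hi⟩ := h0
  exact (hs i).measure_support hi

variable [DecidableEq V]

/-- Integrate one coordinate at a time. The first coordinate in `S` erases the weight, since its `s`
has mean zero; one outside `S` only removes its factor `g`. -/
theorem lmarginal_parityDensity (hs : ∀ i, IsPerturbation (μ i) (g i) (s i)) {t : ℝ}
    (ht : |t| ≤ 1 / 2) (S B : Finset V) (x : ∀ i, Ω i) :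
    (∫⋯∫⁻_B, parityDensity g s S t ∂μ) x =
      (∏ i ∈ Bᶜ, g i (x i)) * if Disjoint S B then parityWeight s S t x else 1 := by
  induction B using Finset.induction_on generalizing x with
  | empty => simp [parityDensity]
  | insert a B ha ih =>
    rw [lmarginal_insert _ (measurable_parityDensity hs S t) ha]
    have hgm := (hs a).measurable_density
    have hsm := (hs a).measurable_sign
    have hcompl : Bᶜ = insert a (insert a B)ᶜ := by
      ext i
      by_cases h : i = a
      · subst h; simp [ha]
      · simp [h]
    have hprod : ∀ y, ∏ i ∈ Bᶜ, g i (Function.update x a y i) =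
        g a y * ∏ i ∈ (insert a B)ᶜ, g i (x i) := fun y => by
      rw [hcompl, Finset.prod_insert (by simp), Function.update_self]
      congr 1
      refine Finset.prod_congr rfl fun i hi => ?_
      rw [Function.update_of_ne]
      rintro rfl
      simp at hi
    have hone : ∫⁻ y, g a y ∂μ a = 1 := by simpa using (hs a).lintegral_mul 0 (by norm_num)
    simp only [ih, hprod]
    by_cases haS : a ∈ S
    · rw [if_neg (fun h => Finset.disjoint_left.1 h haS (Finset.mem_insert_self a B)), mul_one]
      by_cases hd : Disjoint S B
      · simp only [if_pos hd]
        have hw : ∀ y, parityWeight s S t (Function.update x a y) =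
            ENNReal.ofReal (1 + (t * ∏ i ∈ S.erase a, s i (x i)) * s a y) := fun y => by
          have hp : ∏ i ∈ S.erase a, s i (Function.update x a y i) = ∏ i ∈ S.erase a, s i (x i) :=
            Finset.prod_congr rfl fun i hi => by
              rw [Function.update_of_ne (Finset.ne_of_mem_erase hi)]
          rw [parityWeight, ← Finset.mul_prod_erase S _ haS, Function.update_self, hp, mul_assoc,
            mul_comm (s a y)]
        simp only [hw]
        calc _ = ∫⁻ y, (∏ i ∈ (insert a B)ᶜ, g i (x i)) * (g a y *
              ENNReal.ofReal (1 + (t * ∏ i ∈ S.erase a, s i (x i)) * s a y)) ∂μ a := by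
              refine lintegral_congr fun y => ?_
              ring
          _ = _ := by
              rw [lintegral_const_mul _ (by fun_prop),
                (hs a).lintegral_mul _ (abs_mul_prod_le hs ht _ x), mul_one]
      · simp only [if_neg hd, mul_one]
        rw [lintegral_mul_const _ hgm, hone, one_mul]
    · have hw : ∀ y, parityWeight s S t (Function.update x a y) = parityWeight s S t x := fun y => by
        unfold parityWeight
        congr 3
        refine Finset.prod_congr rfl fun i hi => ?_
        rw [Function.update_of_ne]
        rintro rfl
        exact haS hi
      simp only [hw, Finset.disjoint_insert_right, haS, not_false_eq_true, true_and]
      rw [lintegral_mul_const _ (hgm.mul_const _), lintegral_mul_const _ hgm, hone, one_mul]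

theorem marginalDensity_parityDensity (hs : ∀ i, IsPerturbation (μ i) (g i) (s i)) {t : ℝ}
    (ht : |t| ≤ 1 / 2) (S A : Finset V) (x : ∀ i, Ω i) :
    marginalDensity μ (parityDensity g s S t) A x =
      (∏ i ∈ A, g i (x i)) * if S ⊆ A then parityWeight s S t x else 1 := by
  rw [marginalDensity, lmarginal_parityDensity hs ht, compl_compl]
  simp only [disjoint_compl_right_iff]

theorem isPositiveDensity_parityDensity (hs : ∀ i, IsPerturbation (μ i) (g i) (s i)) {t : ℝ}
    (ht : |t| ≤ 1 / 2) {S : Finset V} (hS : S.Nonempty) :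
    IsPositiveDensity μ (parityDensity g s S t) := by
  refine ⟨measurable_parityDensity hs S t, fun x => ⟨?_, ?_⟩, ?_⟩
  · exact pos_iff_ne_zero.2 (mul_ne_zero (Finset.prod_ne_zero_iff.2 fun i _ => (hs i).ne_zero _)
      (parityWeight_ne_zero hs ht S x))
  · exact (ENNReal.mul_ne_top (ENNReal.prod_ne_top fun i _ => (hs i).ne_top _)
      ENNReal.ofReal_ne_top).lt_top
  · have hne : ∀ i, Nonempty (Ω i) := fun i => by
      by_contra h
      rw [not_nonempty_iff] at h
      exact (hs i).measure_support (by simp [Set.eq_empty_of_isEmpty])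
    have x : ∀ i, Ω i := fun i => (hne i).some
    rw [lintegral_eq_lmarginal_univ x, lmarginal_parityDensity hs ht]
    obtain ⟨i, hi⟩ := hS
    have hd : ¬ Disjoint S Finset.univ := fun h => Finset.disjoint_left.1 h hi (Finset.mem_univ i)
    simp [hd]

/-- The weight survives in the quotient exactly when it occurs in the numerator but not in the
denominator. -/
theorem condDensity_parityDensity (hs : ∀ i, IsPerturbation (μ i) (g i) (s i)) {t : ℝ}
    (ht : |t| ≤ 1 / 2) {S B : Finset V} {a : V} (ha : a ∉ B) (x : ∀ i, Ω i) :
    condDensity μ (parityDensity g s S t) a B x =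
      g a (x a) * if S ⊆ insert a B ∧ a ∈ S then parityWeight s S t x else 1 := by
  rw [condDensity, marginalDensity_parityDensity hs ht, marginalDensity_parityDensity hs ht,
    Finset.prod_insert ha]
  have h0 : ∏ i ∈ B, g i (x i) ≠ 0 := Finset.prod_ne_zero_iff.2 fun i _ => (hs i).ne_zero _
  have h1 : ∏ i ∈ B, g i (x i) ≠ ∞ := ENNReal.prod_ne_top fun i _ => (hs i).ne_top _
  have cancel : ∀ p q r : ℝ≥0∞, q ≠ 0 → q ≠ ∞ → p * q * r / q = p * r := fun p q r hq hq' => by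
    rw [div_eq_mul_inv, show p * q * r * q⁻¹ = p * r * (q * q⁻¹) by ring,
      ENNReal.mul_inv_cancel hq hq', mul_one]
  by_cases hB : S ⊆ B
  · have haS : a ∉ S := fun h => ha (hB h)
    rw [if_pos (hB.trans (Finset.subset_insert _ _)), if_pos hB, if_neg (by tauto), mul_assoc,
      mul_div_assoc, ENNReal.div_self, mul_one]
    · exact mul_ne_zero h0 (parityWeight_ne_zero hs ht S x)
    · exact ENNReal.mul_ne_top h1 ENNReal.ofReal_ne_top
  · rw [if_neg hB, mul_one, cancel _ _ _ h0 h1]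
    congr 1
    have : S ⊆ insert a B → a ∈ S := fun h => by
      by_contra haS
      exact hB ((Finset.subset_insert_iff_of_notMem haS).1 h)
    by_cases h : S ⊆ insert a B <;> simp [h, this]

end ParityDensity

/-! ### What the test densities reveal about a DAG. -/

section Separation

variable {V : Type*} [Fintype V] [DecidableEq V] {Ω : V → Type*} [∀ i, MeasurableSpace (Ω i)]
  {μ : ∀ i, Measure (Ω i)} [∀ i, SigmaFinite (μ i)] {g : ∀ i, Ω i → ℝ≥0∞} {s : ∀ i, Ω i → ℝ}

theorem eq_of_subset_insert_pa {D : Digraph V} (hD : IsDAG D) {S : Finset V} {a b : V}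
    (ha : a ∈ S) (hb : b ∈ S) (haS : S ⊆ insert a (pa D a)) (hbS : S ⊆ insert b (pa D b)) :
    a = b := by
  by_contra hab
  have h1 := (mem_pa_iff hD).1 ((Finset.mem_insert.1 (hbS ha)).resolve_left hab)
  have h2 := (mem_pa_iff hD).1 ((Finset.mem_insert.1 (haS hb)).resolve_left (Ne.symm hab))
  exact hD a (.trans (.single h1) (.single h2))

theorem prod_condDensity_parityDensity (hs : ∀ i, IsPerturbation (μ i) (g i) (s i)) {t : ℝ}
    (ht : |t| ≤ 1 / 2) (S : Finset V) (D : Digraph V) (x : ∀ i, Ω i) :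
    ∏ i, condDensity μ (parityDensity g s S t) i (pa D i) x = (∏ i, g i (x i)) *
      ∏ i, if S ⊆ insert i (pa D i) ∧ i ∈ S then parityWeight s S t x else 1 := by
  rw [← Finset.prod_mul_distrib]
  exact Finset.prod_congr rfl fun i _ => condDensity_parityDensity hs ht (notMem_pa i) x

/-- By acyclicity at most one vertex of `S` has all the others as parents, so the weight appears
exactly once in the factorization. -/
theorem parityDensity_mem_markovDensities (hs : ∀ i, IsPerturbation (μ i) (g i) (s i)) {t : ℝ}
    (ht : |t| ≤ 1 / 2) {S : Finset V} {b : V} (hb : b ∈ S) {D : Digraph V} (hD : IsDAG D)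
    (h : t = 0 ∨ S ⊆ insert b (pa D b)) : parityDensity g s S t ∈ markovDensities μ D := by
  refine ⟨isPositiveDensity_parityDensity hs ht ⟨b, hb⟩, ae_of_all _ fun x => ?_⟩
  simp only [prod_condDensity_parityDensity hs ht, parityDensity]
  congr 1
  rcases h with rfl | h
  · simp [parityWeight]
  · rw [Finset.prod_eq_single b, if_pos ⟨h, hb⟩]
    · intro i _ hib
      rw [if_neg]
      exact fun h' => hib (eq_of_subset_insert_pa hD h'.2 hb h'.1 h)
    · simp

theorem exists_of_parityDensity_mem_markovDensities
    (hs : ∀ i, IsPerturbation (μ i) (g i) (s i)) {t : ℝ} (ht : |t| ≤ 1 / 2) (ht0 : t ≠ 0)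
    {S : Finset V} {D : Digraph V} (h : parityDensity g s S t ∈ markovDensities μ D) :
    ∃ i ∈ S, S ⊆ insert i (pa D i) := by
  by_contra! hc
  refine not_parityWeight_ae_eq_one hs ht0 S ?_
  filter_upwards [h.2] with x hx
  rw [prod_condDensity_parityDensity hs ht, Finset.prod_eq_one (fun i _ => if_neg
    fun h' => hc i h'.2 h'.1), parityDensity] at hx
  exact (ENNReal.mul_right_inj (Finset.prod_ne_zero_iff.2 fun i _ => (hs i).ne_zero _)
    (ENNReal.prod_ne_top fun i _ => (hs i).ne_top _)).1 hx

theorem exists_parents_of_interventionalDensities_subset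
    (hμ : ∀ i, ∃ A B : Set (Ω i), MeasurableSet A ∧ MeasurableSet B ∧ Disjoint A B ∧
      0 < μ i A ∧ 0 < μ i B) {ι : Type*} {𝓘 : ι → Finset V} {D₁ D₂ : Digraph V} (hD₁ : IsDAG D₁)
    (h : interventionalDensities μ 𝓘 D₁ ⊆ interventionalDensities μ 𝓘 D₂) {S : Finset V} {b : V}
    (hb : b ∈ S) (hS : S ⊆ insert b (pa D₁ b)) {j : ι} (hj : b ∉ 𝓘 j) :
    ∃ i ∈ S, S ⊆ insert i (pa (interventionGraph D₂ (𝓘 j)) i) := by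
  choose g s hs using fun i => exists_isPerturbation (μ i) (hμ i)
  -- The dependence is switched off when `b` is intervened on. Only the conditional density of `b`
  -- depends on `t`, and it is compared only between targets avoiding `b`, so the tuple satisfies
  -- the invariance condition.
  set t : ι → ℝ := fun k => if b ∈ 𝓘 k then 0 else 1 / 2 with ht
  have ht' : ∀ k, |t k| ≤ 1 / 2 := fun k => by
    simp only [ht]
    split_ifs <;> norm_num [abs_of_pos]
  have hmem : (fun k => parityDensity g s S (t k)) ∈ interventionalDensities μ 𝓘 D₁ := by
    refine ⟨fun k => parityDensity_mem_markovDensities hs (ht' k) hb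
      (hD₁.interventionGraph _) ?_, fun k l a hk hl => ae_of_all _ fun x => ?_⟩
    · rw [pa_interventionGraph hD₁]
      by_cases hbk : b ∈ 𝓘 k
      · exact .inl (if_pos hbk)
      · exact .inr (by rwa [if_neg hbk])
    · rw [condDensity_parityDensity hs (ht' k) (notMem_pa a),
        condDensity_parityDensity hs (ht' l) (notMem_pa a)]
      by_cases ha : S ⊆ insert a (pa D₁ a) ∧ a ∈ S
      · obtain rfl := eq_of_subset_insert_pa hD₁ ha.2 hb ha.1 hS
        simp [ht, hk, hl]
      · simp only [if_neg ha]
  have htj : t j = 1 / 2 := if_neg hj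
  exact exists_of_parityDensity_mem_markovDensities hs (ht' j) (by rw [htj]; norm_num)
    ((h hmem).1 j)

end Separation

/-! ### Markov equivalence implies graph equivalence. -/

section Equivalence

variable {V : Type*}

/-- `a → b ← c` is a v-structure of `D`. -/
def IsVStructure (D : Digraph V) (a b c : V) : Prop :=
  D.Adj a b ∧ D.Adj c b ∧ a ≠ c ∧ ¬ IsAdjacent D a c

/-- `D₁` and `D₂` have the same skeleton and the same v-structures, and every target contains
both or none of the end points of an edge at whose orientation they differ. -/
structure GraphEquivalent {ι : Type*} (𝓘 : ι → Finset V) (D₁ D₂ : Digraph V) : Prop where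
  isAdjacent_iff : ∀ a b, IsAdjacent D₁ a b ↔ IsAdjacent D₂ a b
  isVStructure_iff : ∀ a b c, IsVStructure D₁ a b c ↔ IsVStructure D₂ a b c
  mem_iff : ∀ a b, D₁.Adj a b → D₂.Adj b a → ∀ j, a ∈ 𝓘 j ↔ b ∈ 𝓘 j

theorem IsDAG.not_adj {D : Digraph V} (hD : IsDAG D) {a b : V} (h : D.Adj a b) : ¬ D.Adj b a :=
  fun h' => hD a (.trans (.single h) (.single h'))

theorem IsDAG.ne {D : Digraph V} (hD : IsDAG D) {a b : V} (h : D.Adj a b) : a ≠ b := by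
  rintro rfl
  exact hD a (.single h)

theorem IsDAG.not_adj_of_adj_of_adj {D : Digraph V} (hD : IsDAG D) {a b c : V} (h : D.Adj a b)
    (h' : D.Adj b c) : ¬ D.Adj c a :=
  fun h'' => hD a (.trans (.trans (.single h) (.single h')) (.single h''))

variable [Fintype V] [DecidableEq V] {Ω : V → Type*} [∀ i, MeasurableSpace (Ω i)]
  {μ : ∀ i, Measure (Ω i)} [∀ i, SigmaFinite (μ i)] {ι : Type*} {𝓘 : ι → Finset V}

theorem exists_adj_of_markovEquivalent
    (hμ : ∀ i, ∃ A B : Set (Ω i), MeasurableSet A ∧ MeasurableSet B ∧ Disjoint A B ∧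
      0 < μ i A ∧ 0 < μ i B) {D₁ D₂ : Digraph V} (hD₁ : IsDAG D₁) (hD₂ : IsDAG D₂)
    (h : MarkovEquivalent μ 𝓘 D₁ D₂) {P : Finset V} {b : V} (hP : ∀ a ∈ P, D₁.Adj a b) {j : ι}
    (hj : b ∉ 𝓘 j) :
    ∃ i ∈ insert b P, ∀ a ∈ insert b P, a ≠ i → D₂.Adj a i ∧ i ∉ 𝓘 j := by
  obtain ⟨i, hi, hiS⟩ := exists_parents_of_interventionalDensities_subset hμ hD₁ h.subset
    (Finset.mem_insert_self b P)
    (Finset.insert_subset_insert b fun a ha => (mem_pa_iff hD₁).2 (hP a ha)) hj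
  refine ⟨i, hi, fun a ha hai => ?_⟩
  exact (mem_pa_iff (hD₂.interventionGraph _)).1 ((Finset.mem_insert.1 (hiS ha)).resolve_left hai)

theorem adj_of_markovEquivalent
    (hμ : ∀ i, ∃ A B : Set (Ω i), MeasurableSet A ∧ MeasurableSet B ∧ Disjoint A B ∧
      0 < μ i A ∧ 0 < μ i B) {D₁ D₂ : Digraph V} (hD₁ : IsDAG D₁) (hD₂ : IsDAG D₂)
    (h : MarkovEquivalent μ 𝓘 D₁ D₂) {a b : V} (hab : D₁.Adj a b) {j : ι} (hj : b ∉ 𝓘 j) :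
    D₂.Adj a b ∨ (D₂.Adj b a ∧ a ∉ 𝓘 j) := by
  obtain ⟨i, hi, hiS⟩ := exists_adj_of_markovEquivalent hμ hD₁ hD₂ h (P := {a})
    (by simpa using hab) hj
  have hne := hD₁.ne hab
  rcases Finset.mem_insert.1 hi with rfl | hi
  · exact .inl (hiS a (by simp) hne).1
  · obtain rfl := Finset.mem_singleton.1 hi
    exact .inr (hiS b (by simp) hne.symm)

/-- Test sets of two vertices detect adjacency and the target condition, those of three vertices
detect v-structures. Conservativeness supplies a target avoiding the head. -/
theorem graphEquivalent_of_markovEquivalent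
    (hμ : ∀ i, ∃ A B : Set (Ω i), MeasurableSet A ∧ MeasurableSet B ∧ Disjoint A B ∧
      0 < μ i A ∧ 0 < μ i B) (h𝓘 : IsConservative 𝓘) {D₁ D₂ : Digraph V} (hD₁ : IsDAG D₁)
    (hD₂ : IsDAG D₂) (h : MarkovEquivalent μ 𝓘 D₁ D₂) : GraphEquivalent 𝓘 D₁ D₂ := by
  have skel : ∀ {D₁ D₂ : Digraph V}, IsDAG D₁ → IsDAG D₂ → MarkovEquivalent μ 𝓘 D₁ D₂ →
      ∀ a b, IsAdjacent D₁ a b → IsAdjacent D₂ a b := by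
    intro D₁ D₂ hD₁ hD₂ h a b hab
    have key : ∀ a b, D₁.Adj a b → IsAdjacent D₂ a b := fun a b hab =>
      (adj_of_markovEquivalent hμ hD₁ hD₂ h hab (h𝓘 b).choose_spec).imp_right And.left
    exact hab.elim (key a b) fun h => (key b a h).symm
  have vstr : ∀ {D₁ D₂ : Digraph V}, IsDAG D₁ → IsDAG D₂ → MarkovEquivalent μ 𝓘 D₁ D₂ →
      ∀ a b c, IsVStructure D₁ a b c → IsVStructure D₂ a b c := by
    rintro D₁ D₂ hD₁ hD₂ h a b c ⟨hab, hcb, hac, hn⟩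
    have hn' : ¬ IsAdjacent D₂ a c := fun h' => hn (skel hD₂ hD₁ h.symm a c h')
    obtain ⟨j, hj⟩ := h𝓘 b
    obtain ⟨i, hi, hiS⟩ := exists_adj_of_markovEquivalent hμ hD₁ hD₂ h (P := {a, c})
      (by simp [hab, hcb]) hj
    simp only [Finset.mem_insert, Finset.mem_singleton] at hi hiS
    -- The vertex receiving edges from the other two must be `b`, since otherwise `a` and `c` would
    -- be adjacent.
    rcases hi with rfl | rfl | rfl
    · exact ⟨(hiS a (by simp) (hD₁.ne hab)).1, (hiS c (by simp) (hD₁.ne hcb)).1, hac, hn'⟩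
    · exact absurd (.inr (hiS c (by simp) hac.symm).1) hn'
    · exact absurd (.inl (hiS a (by simp) hac).1) hn'
  refine ⟨fun a b => ⟨skel hD₁ hD₂ h a b, skel hD₂ hD₁ h.symm a b⟩,
    fun a b c => ⟨vstr hD₁ hD₂ h a b c, vstr hD₂ hD₁ h.symm a b c⟩, fun a b hab hba j => ?_⟩
  have h1 : b ∉ 𝓘 j → a ∉ 𝓘 j := fun hj =>
    ((adj_of_markovEquivalent hμ hD₁ hD₂ h hab hj).resolve_left (hD₂.not_adj hba)).2
  have h2 : a ∉ 𝓘 j → b ∉ 𝓘 j := fun hj =>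
    ((adj_of_markovEquivalent hμ hD₂ hD₁ h.symm hba hj).resolve_left (hD₁.not_adj hab)).2
  tauto

end Equivalence

/-! ### Graph equivalent DAGs are joined by covered edge reversals. -/

section Covered

variable {V : Type*}

theorem reflTransGen_of_transGen_addEdge {D : Digraph V} {u v a b : V}
    (h : Relation.TransGen (addEdge D u v).Adj a b) :
    Relation.TransGen D.Adj a b ∨
      (Relation.ReflTransGen D.Adj a u ∧ Relation.ReflTransGen D.Adj v b) := by
  induction h with
  | single h =>
    rcases h with h | ⟨rfl, rfl⟩
    · exact .inl (.single h)
    · exact .inr ⟨.refl, .refl⟩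
  | tail _ h ih =>
    rcases h with h | ⟨rfl, rfl⟩
    · exact ih.imp (fun h' => h'.tail h) fun h' => ⟨h'.1, h'.2.tail h⟩
    · exact .inr ⟨ih.elim (fun h' => h'.to_reflTransGen) And.left, .refl⟩

theorem IsDAG.addEdge {D : Digraph V} (hD : IsDAG D) {u v : V}
    (h : ¬ Relation.ReflTransGen D.Adj v u) : IsDAG (addEdge D u v) := fun a ha =>
  (reflTransGen_of_transGen_addEdge ha).elim (hD a) fun h' => h (h'.2.trans h'.1)

theorem IsDAG.of_le {D D' : Digraph V} (hD : IsDAG D) (h : D' ≤ D) : IsDAG D' :=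
  fun a ha => hD a (Relation.TransGen.mono (fun _ _ h' => h h') a a ha)

theorem removeEdge_le (D : Digraph V) (u v : V) : removeEdge D u v ≤ D := fun _ _ h => h.1

/-- The graph in which the edge from `x` to `y` is turned. -/
def turnEdge (D : Digraph V) (x y : V) : Digraph V := addEdge (removeEdge D x y) y x

/-- The edge `x → y` of `D` is covered: apart from `x`, the vertices `x` and `y` have the same
parents. -/
structure IsCovered (D : Digraph V) (x y : V) : Prop where
  adj : D.Adj x y
  adj_iff : ∀ z, z ≠ x → (D.Adj z y ↔ D.Adj z x)

/-- A cycle needs a second path from `x` to `y`. Its last edge starts at a parent of `y` other than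
`x`, hence at a parent of `x`, which closes a cycle in `D`. -/
theorem IsCovered.isDAG_turnEdge {D : Digraph V} (hD : IsDAG D) {x y : V} (h : IsCovered D x y) :
    IsDAG (turnEdge D x y) := by
  refine (hD.of_le (removeEdge_le D x y)).addEdge fun hp => ?_
  rcases Relation.ReflTransGen.cases_tail hp with rfl | ⟨z, hz, hzy⟩
  · exact hD _ (.single h.adj)
  · have hzx : z ≠ x := fun e => hzy.2 ⟨e, rfl⟩
    refine hD x (Relation.TransGen.tail' ?_ ((h.adj_iff z hzx).1 hzy.1))
    exact Relation.ReflTransGen.mono (fun _ _ h' => h'.1) x z hz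

theorem turnEdge_adj {D : Digraph V} {x y a b : V} :
    (turnEdge D x y).Adj a b ↔ (D.Adj a b ∧ ¬ (a = x ∧ b = y)) ∨ (a = y ∧ b = x) := Iff.rfl

theorem isAdjacent_turnEdge_iff {D : Digraph V} {x y : V} (h : D.Adj x y) (a b : V) :
    IsAdjacent (turnEdge D x y) a b ↔ IsAdjacent D a b := by
  simp only [IsAdjacent, turnEdge_adj]
  grind

theorem IsCovered.isVStructure_turnEdge_iff {D : Digraph V} (hD : IsDAG D) {x y : V}
    (h : IsCovered D x y) (a b c : V) :
    IsVStructure (turnEdge D x y) a b c ↔ IsVStructure D a b c := by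
  simp only [IsVStructure, isAdjacent_turnEdge_iff h.adj]
  have h1 := h.adj_iff
  have h2 := h.adj
  have h3 := hD.not_adj h2
  have h4 := hD.ne h2
  simp only [IsAdjacent, turnEdge_adj]
  grind

variable [Fintype V]

theorem IsDAG.wellFounded {D : Digraph V} (hD : IsDAG D) :
    WellFounded (Relation.TransGen D.Adj) := by
  have : Std.Irrefl (Relation.TransGen D.Adj) := ⟨hD⟩
  exact Finite.wellFounded_of_trans_of_irrefl _

theorem IsDAG.wellFounded_swap {D : Digraph V} (hD : IsDAG D) :
    WellFounded (fun a b => Relation.TransGen D.Adj b a) := by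
  have : Std.Irrefl (fun a b => Relation.TransGen D.Adj b a) := ⟨hD⟩
  have : IsTrans V (fun a b => Relation.TransGen D.Adj b a) := ⟨fun _ _ _ h h' => h'.trans h⟩
  exact Finite.wellFounded_of_trans_of_irrefl _

/-- Among the edges oriented differently, choose one whose head `y` is earliest in `D₁` and then
whose tail `x` is latest. A vertex violating coveredness would produce a v-structure in only one of
the graphs or a directed triangle. -/
theorem GraphEquivalent.exists_isCovered {ι : Type*} {𝓘 : ι → Finset V} {D₁ D₂ : Digraph V}
    (hD₁ : IsDAG D₁) (hD₂ : IsDAG D₂) (h : GraphEquivalent 𝓘 D₁ D₂)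
    (hne : ∃ a b, D₁.Adj a b ∧ D₂.Adj b a) :
    ∃ x y, IsCovered D₁ x y ∧ D₂.Adj y x := by
  obtain ⟨y, ⟨x₀, hx₀⟩, hymin⟩ := hD₁.wellFounded.has_min {b | ∃ a, D₁.Adj a b ∧ D₂.Adj b a}
    (by obtain ⟨a, b, hab⟩ := hne; exact ⟨b, a, hab⟩)
  obtain ⟨x, ⟨hxy, hyx⟩, hxmax⟩ := hD₁.wellFounded_swap.has_min {a | D₁.Adj a y ∧ D₂.Adj y a}
    ⟨x₀, hx₀⟩
  have hmin : ∀ a b, D₁.Adj b y → D₁.Adj a b → ¬ D₂.Adj b a := fun a b hby hab hba =>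
    hymin b ⟨a, hab, hba⟩ (.single hby)
  have hmax : ∀ z, D₁.Adj x z → D₁.Adj z y → ¬ D₂.Adj y z := fun z hxz hzy hyz =>
    hxmax z ⟨hzy, hyz⟩ (.single hxz)
  refine ⟨x, y, ⟨hxy, fun z hzx => ⟨fun hzy => ?_, fun hzx' => ?_⟩⟩, hyx⟩
  · by_contra hn
    have hadj : IsAdjacent D₁ z x := by
      by_contra hn'
      exact hD₂.not_adj hyx ((h.isVStructure_iff z y x).1 ⟨hzy, hxy, hzx, hn'⟩).2.1
    have hxz := hadj.resolve_left hn
    have hzy₂ : D₂.Adj z y := ((h.isAdjacent_iff z y).1 (.inl hzy)).resolve_right (hmax z hxz hzy)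
    have hxz₂ : D₂.Adj x z := ((h.isAdjacent_iff x z).1 (.inl hxz)).resolve_right
      (hmin x z hzy hxz)
    exact hD₂.not_adj_of_adj_of_adj hxz₂ hzy₂ hyx
  · have hzx₂ : D₂.Adj z x := ((h.isAdjacent_iff z x).1 (.inl hzx')).resolve_right
      (hmin z x hxy hzx')
    have hzy : z ≠ y := by
      rintro rfl
      exact hD₁.not_adj hxy hzx'
    have hadj : IsAdjacent D₁ z y := by
      by_contra hn
      have := ((h.isVStructure_iff z x y).2
        ⟨hzx₂, hyx, hzy, fun h' => hn ((h.isAdjacent_iff z y).2 h')⟩).2.1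
      exact hD₁.not_adj hxy this
    exact hadj.resolve_right fun h' => hD₁.not_adj_of_adj_of_adj hxy h' hzx'

variable [DecidableEq V] {Ω : V → Type*} [∀ i, MeasurableSpace (Ω i)]
  {μ : ∀ i, Measure (Ω i)} [∀ i, SigmaFinite (μ i)]

theorem IsCovered.markovEquivalent_turnEdge (hμ : ∀ i, μ i ≠ 0) {ι : Type*} {𝓘 : ι → Finset V}
    {D : Digraph V} (hD : IsDAG D) {x y : V} (h : IsCovered D x y)
    (hI : ∀ j, x ∈ 𝓘 j ↔ y ∈ 𝓘 j) : MarkovEquivalent μ 𝓘 D (turnEdge D x y) := by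
  have hD' := h.isDAG_turnEdge hD
  have hxy := hD.ne h.adj
  have hyx := hD.not_adj h.adj
  have h1 := h.adj_iff
  have h2 := h.adj
  have e1 : pa D y = insert x (pa D x) := by
    ext z
    rw [Finset.mem_insert, mem_pa_iff hD, mem_pa_iff hD]
    grind
  have e2 : pa (turnEdge D x y) x = insert y (pa D x) := by
    ext z
    rw [Finset.mem_insert, mem_pa_iff hD, mem_pa_iff hD', turnEdge_adj]
    grind
  have e3 : pa (turnEdge D x y) y = pa D x := by
    ext z
    rw [mem_pa_iff hD, mem_pa_iff hD', turnEdge_adj]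
    have h4 : ¬ D.Adj x x := fun h' => hD x (.single h')
    grind
  have e4 : ∀ c, c ≠ x → c ≠ y → pa (turnEdge D x y) c = pa D c := by
    intro c hcx hcy
    ext z
    rw [mem_pa_iff hD, mem_pa_iff hD', turnEdge_adj]
    grind
  have hx : x ∉ pa D x := notMem_pa x
  have hy : y ∉ pa D x := fun h' => hyx ((mem_pa_iff hD).1 h')
  exact subset_antisymm
    (interventionalDensities_subset_of_covered hμ hD hD' hxy hx rfl e1 e2 e3 e4 hI)
    (interventionalDensities_subset_of_covered hμ hD' hD hxy.symm hy e3 e2 e1 rfl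
      (fun c hcy hcx => (e4 c hcx hcy).symm) fun j => (hI j).symm)

/-- Induction on the number of edges oriented differently: turning a covered one lowers it and keeps
graph equivalence. -/
theorem markovEquivalent_of_graphEquivalent (hμ : ∀ i, μ i ≠ 0) {ι : Type*} {𝓘 : ι → Finset V}
    {D₁ D₂ : Digraph V} (hD₁ : IsDAG D₁) (hD₂ : IsDAG D₂) (h : GraphEquivalent 𝓘 D₁ D₂) :
    MarkovEquivalent μ 𝓘 D₁ D₂ := by
  classical
  generalize hn : (Finset.univ.filter fun q : V × V => D₁.Adj q.1 q.2 ∧ D₂.Adj q.2 q.1).card = n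
  induction n using Nat.strong_induction_on generalizing D₁ with
  | _ n ih =>
  by_cases hne : ∃ a b, D₁.Adj a b ∧ D₂.Adj b a
  · obtain ⟨x, y, hc, hyx⟩ := h.exists_isCovered hD₁ hD₂ hne
    have hI := h.mem_iff x y hc.adj hyx
    have hD' := hc.isDAG_turnEdge hD₁
    refine (hc.markovEquivalent_turnEdge hμ hD₁ hI).trans (ih _ ?_ hD' ⟨fun a b => ?_,
      fun a b c => ?_, fun a b hab hba => ?_⟩ rfl)
    · rw [← hn]
      refine Finset.card_lt_card (Finset.ssubset_iff_of_subset ?_ |>.2 ⟨(x, y), ?_, ?_⟩)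
      · rintro ⟨a, b⟩
        simp only [Finset.mem_filter, Finset.mem_univ, true_and, turnEdge_adj]
        rintro ⟨⟨hab, -⟩ | ⟨rfl, rfl⟩, hba⟩
        · exact ⟨hab, hba⟩
        · exact absurd hba (hD₂.not_adj hyx)
      · simpa using ⟨hc.adj, hyx⟩
      · simp [turnEdge_adj, hD₁.ne hc.adj]
    · rw [isAdjacent_turnEdge_iff hc.adj, h.isAdjacent_iff]
    · rw [hc.isVStructure_turnEdge_iff hD₁, h.isVStructure_iff]
    · rcases hab with hab | ⟨rfl, rfl⟩
      · exact h.mem_iff a b hab.1 hba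
      · exact absurd hba (hD₂.not_adj hyx)
  · have : D₁ = D₂ := by
      ext a b
      push Not at hne
      have h1 := h.isAdjacent_iff a b
      have h2 := hne a b
      have h3 := hne b a
      have h4 : D₂.Adj a b → ¬ D₂.Adj b a := hD₂.not_adj
      simp only [IsAdjacent] at h1
      tauto
    rw [this]
    rfl

end Covered

/-! ### Combinatorics of essential graphs. -/

section EssentialGraphs

variable {V : Type*} {ι : Type*} {𝓘 : ι → Finset V}

theorem GraphEquivalent.refl {D : Digraph V} (hD : IsDAG D) : GraphEquivalent 𝓘 D D :=
  ⟨fun _ _ => Iff.rfl, fun _ _ _ => Iff.rfl, fun _ _ h h' => absurd h' (hD.not_adj h)⟩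

theorem GraphEquivalent.symm {D₁ D₂ : Digraph V} (h : GraphEquivalent 𝓘 D₁ D₂) :
    GraphEquivalent 𝓘 D₂ D₁ :=
  ⟨fun a b => (h.1 a b).symm, fun a b c => (h.2 a b c).symm,
    fun a b h1 h2 j => (h.3 b a h2 h1 j).symm⟩

theorem GraphEquivalent.trans {D₁ D₂ D₃ : Digraph V} (h : GraphEquivalent 𝓘 D₁ D₂)
    (h' : GraphEquivalent 𝓘 D₂ D₃) : GraphEquivalent 𝓘 D₁ D₃ :=
  ⟨fun a b => (h.1 a b).trans (h'.1 a b), fun a b c => (h.2 a b c).trans (h'.2 a b c),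
    fun a b h1 h2 => ((h.1 a b).1 (.inl h1)).elim (fun h3 => h'.3 a b h3 h2)
      fun h3 => h.3 a b h1 h3⟩

/-- `G` is the union of all DAGs that are graph equivalent to `D`. -/
structure IsEssentialFor (𝓘 : ι → Finset V) (G D : Digraph V) : Prop where
  isDAG : IsDAG D
  adj_iff : ∀ a b, G.Adj a b ↔ ∃ D', IsDAG D' ∧ GraphEquivalent 𝓘 D' D ∧ D'.Adj a b

variable {G D E : Digraph V} {a b c v w : V}

namespace IsEssentialFor

theorem of_graphEquivalent (h : IsEssentialFor 𝓘 G D) (hE : IsDAG E)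
    (hED : GraphEquivalent 𝓘 E D) : IsEssentialFor 𝓘 G E :=
  ⟨hE, fun a b => (h.adj_iff a b).trans
    ⟨fun ⟨D', h1, h2, h3⟩ => ⟨D', h1, h2.trans hED.symm, h3⟩,
      fun ⟨D', h1, h2, h3⟩ => ⟨D', h1, h2.trans hED, h3⟩⟩⟩

theorem exists_adj (h : IsEssentialFor 𝓘 G D) (hab : G.Adj a b) :
    ∃ E, IsEssentialFor 𝓘 G E ∧ GraphEquivalent 𝓘 E D ∧ E.Adj a b :=
  let ⟨E, h1, h2, h3⟩ := (h.adj_iff a b).1 hab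
  ⟨E, h.of_graphEquivalent h1 h2, h2, h3⟩

theorem adj (h : IsEssentialFor 𝓘 G D) (hab : D.Adj a b) : G.Adj a b :=
  (h.adj_iff a b).2 ⟨D, h.isDAG, .refl h.isDAG, hab⟩

theorem isAdjacent_iff (h : IsEssentialFor 𝓘 G D) (a b : V) :
    IsAdjacent G a b ↔ IsAdjacent D a b := by
  have key : ∀ a b, G.Adj a b → IsAdjacent D a b := fun a b hab =>
    let ⟨_, _, h2, h3⟩ := h.exists_adj hab
    (h2.isAdjacent_iff a b).1 (.inl h3)
  exact ⟨fun h' => h'.elim (key a b) fun h' => (key b a h').symm, fun h' => h'.imp h.adj h.adj⟩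

theorem adj_of_isArrow (h : IsEssentialFor 𝓘 G D) (hab : IsArrow G a b) : D.Adj a b :=
  ((h.isAdjacent_iff a b).1 (.inl hab.1)).resolve_right fun h' => hab.2 (h.adj h')

theorem mem_iff (h : IsEssentialFor 𝓘 G D) (hab : IsLine G a b) (j : ι) : a ∈ 𝓘 j ↔ b ∈ 𝓘 j :=
  let ⟨_, _, h2, h3⟩ := h.exists_adj hab.1
  let ⟨_, _, h5, h6⟩ := h.exists_adj hab.2
  (h2.trans h5.symm).mem_iff a b h3 h6 j

theorem isVStructure_iff (h : IsEssentialFor 𝓘 G D) (a b c : V) :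
    IsVStructure D a b c ↔ IsArrow G a b ∧ IsArrow G c b ∧ a ≠ c ∧ ¬ IsAdjacent G a c := by
  rw [h.isAdjacent_iff a c]
  refine ⟨fun hv => ⟨⟨h.adj hv.1, fun hba => ?_⟩, ⟨h.adj hv.2.1, fun hbc => ?_⟩, hv.2.2⟩,
    fun hv => ⟨h.adj_of_isArrow hv.1, h.adj_of_isArrow hv.2.1, hv.2.2⟩⟩
  · obtain ⟨E, hE, hED, hE'⟩ := h.exists_adj hba
    exact hE.isDAG.not_adj hE' ((hED.isVStructure_iff a b c).2 hv).1
  · obtain ⟨E, hE, hED, hE'⟩ := h.exists_adj hbc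
    exact hE.isDAG.not_adj hE' ((hED.isVStructure_iff a b c).2 hv).2.1

/-- The target condition is automatic: an edge on which `E` and `D` disagree is a line of `G`. -/
theorem of_isVStructure_iff (h : IsEssentialFor 𝓘 G D) (hE : IsDAG E)
    (hEG : ∀ a b, E.Adj a b → G.Adj a b) (hadj : ∀ a b, IsAdjacent G a b ↔ IsAdjacent E a b)
    (hv : ∀ a b c, IsVStructure E a b c ↔ IsVStructure D a b c) : IsEssentialFor 𝓘 G E :=
  h.of_graphEquivalent hE ⟨fun a b => (hadj a b).symm.trans (h.isAdjacent_iff a b), hv,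
    fun _ _ h1 h2 j => h.mem_iff ⟨hEG _ _ h1, h.adj h2⟩ j⟩

/-- Otherwise a member with `c → b` has a v-structure at `b`, which forces `c → b` to be an arrow of
`G`. -/
theorem isAdjacent_of_isArrow_of_isLine (h : IsEssentialFor 𝓘 G D) (hab : IsArrow G a b)
    (hbc : IsLine G b c) : IsAdjacent G a c := by
  by_contra hn
  have hac : a ≠ c := by
    rintro rfl
    exact hab.2 hbc.1
  obtain ⟨E, hE, -, hcb⟩ := h.exists_adj hbc.2
  rw [hE.isAdjacent_iff] at hn
  exact ((hE.isVStructure_iff a b c).1 ⟨hE.adj_of_isArrow hab, hcb, hac, hn⟩).2.1.2 hbc.1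

end IsEssentialFor

theorem mem_chainComponent_self (G : Digraph V) (v : V) : v ∈ chainComponent G v := ⟨.refl, .refl⟩

theorem mem_chainComponent_of_adj (hav : a ∈ chainComponent G v) (hab : G.Adj a b)
    (hba : G.Adj b a) : b ∈ chainComponent G v :=
  ⟨hav.1.tail hab, .head hba hav.2⟩

theorem IsLine.mem_chainComponent_iff (h : IsLine G a b) :
    a ∈ chainComponent G v ↔ b ∈ chainComponent G v :=
  ⟨fun h' => mem_chainComponent_of_adj h' h.1 h.2, fun h' => mem_chainComponent_of_adj h' h.2 h.1⟩

theorem adj_symm_of_skeleton_eq (h : skeleton D = skeleton G) (a b : V) :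
    IsAdjacent G a b ↔ IsAdjacent D a b :=
  (iff_of_eq (congrFun (congrFun (congrArg Digraph.Adj h) a) b)).symm

/-- Two parents of `b` inside its chain component are adjacent by the perfect elimination ordering.
If one lies outside, its edge is an arrow of `G`; for nonadjacent parents, the absence of induced `a
→ b — c` makes the other edge an arrow too. -/
theorem IsEssentialFor.of_mem_representatives (h : IsEssentialFor 𝓘 G E)
    (hD : D ∈ representatives G) : IsEssentialFor 𝓘 G D := by
  obtain ⟨hdag, hle, hskel, hpeo⟩ := hD
  have hadj := adj_symm_of_skeleton_eq hskel
  refine h.of_isVStructure_iff hdag (fun _ _ h' => hle h') hadj fun a b c => ?_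
  rw [h.isVStructure_iff]
  have harrow : ∀ {x y}, IsArrow G x y → D.Adj x y := fun {x y} hxy =>
    ((hadj x y).1 (.inl hxy.1)).resolve_right fun h' => hxy.2 (hle h')
  refine ⟨fun ⟨hab, hcb, hac, hn⟩ => ?_, fun ⟨hab, hcb, hac, hn⟩ =>
    ⟨harrow hab, harrow hcb, hac, by rwa [← hadj]⟩⟩
  rw [← hadj] at hn
  have hside : ∀ {x y}, D.Adj x b → D.Adj y b → ¬ IsAdjacent G x y →
      x ∉ chainComponent G b → IsArrow G x b ∧ IsArrow G y b := by
    intro x y hxb hyb hxy hx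
    have hx' : IsArrow G x b := ⟨hle hxb, fun hbx =>
      hx (mem_chainComponent_of_adj (mem_chainComponent_self G b) hbx (hle hxb))⟩
    exact ⟨hx', hle hyb, fun hby => hxy (h.isAdjacent_of_isArrow_of_isLine hx' ⟨hby, hle hyb⟩)⟩
  by_cases ha : a ∈ chainComponent G b
  · by_cases hc : c ∈ chainComponent G b
    · exfalso
      obtain ⟨σ, h1, h2⟩ := hpeo b
      have hb := mem_chainComponent_self G b
      have hab' := h2 ⟨a, ha⟩ ⟨b, hb⟩ hab
      have hcb' := h2 ⟨c, hc⟩ ⟨b, hb⟩ hcb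
      have := h1 (σ.symm ⟨b, hb⟩) (σ.symm ⟨a, ha⟩) (σ.symm ⟨c, hc⟩) hab' hcb'
        (fun e => hac (congrArg Subtype.val (σ.symm.injective e)))
      simp only [Equiv.apply_symm_apply] at this
      exact hn (this (.inl (hle hab)) (.inl (hle hcb)))
    · have := hside hcb hab (fun h' => hn h'.symm) hc
      exact ⟨this.2, this.1, hac, hn⟩
  · have := hside hab hcb hn ha
    exact ⟨this.1, this.2, hac, hn⟩

/-! ### Splicing two members of the class along a chain component. -/

section OrientAs

theorem adj_of_orientAs_adj {H : Digraph V} {T : Set V} (hD : ∀ a b, D.Adj a b → H.Adj a b)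
    (hE : ∀ a b, E.Adj a b → H.Adj a b) (h : (orientAs E D T).Adj a b) : H.Adj a b :=
  h.elim (fun h' => hD _ _ h'.2.2) fun h' => hE _ _ h'.2

theorem transGen_of_orientAs_of_mem (hD : ∀ a b, D.Adj a b → G.Adj a b)
    (hE : ∀ a b, E.Adj a b → G.Adj a b) (hb : b ∈ chainComponent G v)
    (h : Relation.TransGen (orientAs E D (chainComponent G v)).Adj a b)
    (ha : a ∈ chainComponent G v) : Relation.TransGen D.Adj a b := by
  have hG : ∀ a b, (orientAs E D (chainComponent G v)).Adj a b → G.Adj a b :=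
    fun _ _ => adj_of_orientAs_adj hD hE
  induction h using Relation.TransGen.head_induction_on with
  | single h => exact .single (h.elim (fun h' => h'.2.2) fun h' => absurd ⟨ha, hb⟩ h'.1)
  | head h h' ih =>
    rename_i x y
    have hy : y ∈ chainComponent G v := ⟨ha.1.tail (hG _ _ h),
      (Relation.ReflTransGen.mono hG _ _ h'.to_reflTransGen).trans hb.2⟩
    exact .head (h.elim (fun h' => h'.2.2) fun h' => absurd ⟨ha, hy⟩ h'.1) (ih hy)

theorem transGen_of_orientAs_of_notMem (hD : ∀ a b, D.Adj a b → G.Adj a b)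
    (hE : ∀ a b, E.Adj a b → G.Adj a b)
    (h : Relation.TransGen (orientAs E D (chainComponent G v)).Adj a b)
    (ha : a ∉ chainComponent G v) (hba : Relation.ReflTransGen G.Adj b a) :
    Relation.TransGen E.Adj a b := by
  have hG : ∀ a b, (orientAs E D (chainComponent G v)).Adj a b → G.Adj a b :=
    fun _ _ => adj_of_orientAs_adj hD hE
  induction h using Relation.TransGen.head_induction_on with
  | single h => exact .single (h.elim (fun h' => absurd h'.1 ha) fun h' => h'.2)
  | head h h' ih =>
    rename_i x y
    have hyx : Relation.ReflTransGen G.Adj y x :=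
      (Relation.ReflTransGen.mono hG _ _ h'.to_reflTransGen).trans hba
    have hxy := hG _ _ h
    refine .head (h.elim (fun h' => absurd h'.1 ha) fun h' => h'.2) (ih (fun hy => ha ?_)
      (hba.tail hxy))
    exact ⟨hy.1.trans hyx, .head hxy hy.2⟩

theorem orientAs_adj_iff_of_notMem {T : Set V} (hb : b ∉ T) :
    (orientAs E D T).Adj a b ↔ E.Adj a b := by
  simp [orientAs, hb]

theorem orientAs_adj_iff_of_mem (hD : IsEssentialFor 𝓘 G D) (hE : IsEssentialFor 𝓘 G E)
    (hb : b ∈ chainComponent G v) :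
    (orientAs E D (chainComponent G v)).Adj a b ↔ D.Adj a b := by
  by_cases ha : a ∈ chainComponent G v
  · simp [orientAs, ha, hb]
  · have harrow : G.Adj a b → IsArrow G a b := fun h =>
      ⟨h, fun h' => ha (mem_chainComponent_of_adj hb h' h)⟩
    simp only [orientAs, ha, false_and, not_false_eq_true, true_and, false_or]
    exact ⟨fun h => hD.adj_of_isArrow (harrow (hE.adj h)),
      fun h => hE.adj_of_isArrow (harrow (hD.adj h))⟩

/-- A cycle stays in one chain component, where the splice agrees with `D` or with `E`. V-structures
depend on the edges into their head, and these are all taken from one of the two DAGs, since edges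
entering a component are arrows of `G`. -/
theorem IsEssentialFor.orientAs (hD : IsEssentialFor 𝓘 G D) (hE : IsEssentialFor 𝓘 G E) (v : V) :
    IsEssentialFor 𝓘 G (orientAs E D (chainComponent G v)) := by
  have hDG : ∀ a b, D.Adj a b → G.Adj a b := fun _ _ => hD.adj
  have hEG : ∀ a b, E.Adj a b → G.Adj a b := fun _ _ => hE.adj
  have hadj : ∀ a b, IsAdjacent G a b ↔
      IsAdjacent (IntervGraph.orientAs E D (chainComponent G v)) a b := by
    intro a b
    by_cases h : a ∈ chainComponent G v ∧ b ∈ chainComponent G v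
    · rw [hD.isAdjacent_iff]
      simp [IsAdjacent, IntervGraph.orientAs, h.1, h.2]
    · rw [hE.isAdjacent_iff]
      simp only [IsAdjacent, IntervGraph.orientAs]
      tauto
  refine hD.of_isVStructure_iff (fun a ha => ?_) (fun _ _ => adj_of_orientAs_adj hDG hEG) hadj
    fun a b c => ?_
  · by_cases hav : a ∈ chainComponent G v
    · exact hD.isDAG a (transGen_of_orientAs_of_mem hDG hEG hav ha hav)
    · exact hE.isDAG a (transGen_of_orientAs_of_notMem hDG hEG ha hav .refl)
  · by_cases hb : b ∈ chainComponent G v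
    · simp only [IsVStructure, orientAs_adj_iff_of_mem hD hE hb, ← hadj, hD.isAdjacent_iff]
    · rw [hD.isVStructure_iff, ← hE.isVStructure_iff]
      simp only [IsVStructure, orientAs_adj_iff_of_notMem hb, ← hadj, hE.isAdjacent_iff]

/-- The orientation of `D` can be changed outside two chain components so that it contains a
given edge of `G`. -/
theorem IsEssentialFor.exists_reorientation (hD : IsEssentialFor 𝓘 G D) (v w : V)
    (hab : G.Adj a b) (hv : ¬ (a ∈ chainComponent G v ∧ b ∈ chainComponent G v))
    (hw : ¬ (a ∈ chainComponent G w ∧ b ∈ chainComponent G w)) :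
    ∃ E, IsEssentialFor 𝓘 G E ∧ E.Adj a b ∧
      ∀ y, y ∈ chainComponent G v ∨ y ∈ chainComponent G w → ∀ x, E.Adj x y ↔ D.Adj x y := by
  obtain ⟨E, hE, -, hE'⟩ := hD.exists_adj hab
  have hF := hD.orientAs hE v
  refine ⟨_, hD.orientAs hF w, .inr ⟨hw, .inr ⟨hv, hE'⟩⟩, fun y hy x => ?_⟩
  by_cases hyw : y ∈ chainComponent G w
  · exact orientAs_adj_iff_of_mem hD hF hyw
  · rw [orientAs_adj_iff_of_notMem hyw, orientAs_adj_iff_of_mem hD hE (hy.resolve_right hyw)]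

end OrientAs

/-! ### Transfer of directed paths between members of the class. -/

section Paths

theorem IsEssentialFor.adj_of_isArrow_of_isLine (hE : IsEssentialFor 𝓘 G E) (hab : IsArrow G a b)
    (hbc : IsLine G b c) (hbc' : E.Adj b c) : E.Adj a c :=
  ((hE.isAdjacent_iff a c).1 (hE.isAdjacent_of_isArrow_of_isLine hab hbc)).resolve_right
    (hE.isDAG.not_adj_of_adj_of_adj (hE.adj_of_isArrow hab) hbc')

/-- Every path in a DAG of the equivalence class can be replaced by one that uses lines of `G`
first and arrows of `G` thereafter. -/
theorem IsEssentialFor.exists_lines_arrows (hE : IsEssentialFor 𝓘 G E)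
    (h : Relation.ReflTransGen E.Adj v w) :
    ∃ y, Relation.ReflTransGen (fun a b => E.Adj a b ∧ IsLine G a b) v y ∧
      Relation.ReflTransGen (IsArrow G) y w := by
  induction h using Relation.ReflTransGen.head_induction_on with
  | refl => exact ⟨w, .refl, .refl⟩
  | head h h' ih =>
    rename_i x a
    obtain ⟨y, hay, hyw⟩ := ih
    by_cases hax : G.Adj a x
    · exact ⟨y, .head ⟨h, hE.adj h, hax⟩ hay, hyw⟩
    have hxa : IsArrow G x a := ⟨hE.adj h, hax⟩
    clear h h' hax
    -- An arrow `x → a` before a line `a — c` is replaced by the edge `x → c`. This repeats until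
    -- that edge is a line, which then heads the line segment, or no lines remain.
    induction hay using Relation.ReflTransGen.head_induction_on with
    | refl => exact ⟨x, .refl, .head hxa hyw⟩
    | head h hcy ih =>
      rename_i a c
      have hxc := hE.adj_of_isArrow_of_isLine hxa h.2 h.1
      by_cases hcx : G.Adj c x
      · exact ⟨y, .head ⟨hxc, hE.adj hxc, hcx⟩ hcy, hyw⟩
      · exact ih ⟨hE.adj hxc, hcx⟩

theorem IsEssentialFor.reflTransGen_of_arrows (hD : IsEssentialFor 𝓘 G D)
    (h : Relation.ReflTransGen (IsArrow G) v w) : Relation.ReflTransGen D.Adj v w :=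
  Relation.ReflTransGen.mono (fun _ _ => hD.adj_of_isArrow) v w h

theorem IsEssentialFor.reflTransGen_of_agree (hD : IsEssentialFor 𝓘 G D)
    (hE : IsEssentialFor 𝓘 G E)
    (hED : ∀ y ∈ chainComponent G v, ∀ x, E.Adj x y ↔ D.Adj x y) (ha : a ∈ chainComponent G v)
    (h : Relation.ReflTransGen E.Adj a w) : Relation.ReflTransGen D.Adj a w := by
  obtain ⟨y, h1, h2⟩ := hE.exists_lines_arrows h
  refine Relation.ReflTransGen.trans ?_ (hD.reflTransGen_of_arrows h2)
  suffices y ∈ chainComponent G v ∧ Relation.ReflTransGen D.Adj a y from this.2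
  clear h2
  induction h1 with
  | refl => exact ⟨ha, .refl⟩
  | tail _ h ih =>
    have hm := h.2.mem_chainComponent_iff.1 ih.1
    exact ⟨hm, ih.2.tail ((hED _ hm _).1 h.1)⟩

/-- For turning `v → u`, the transferred path must again avoid this edge as its first step, so
shortcuts are stopped before they reach `u`. -/
theorem IsEssentialFor.exists_path_of_agree (hD : IsEssentialFor 𝓘 G D)
    (hE : IsEssentialFor 𝓘 G E) {u x : V}
    (hv : ∀ y ∈ chainComponent G v, ∀ x, E.Adj x y ↔ D.Adj x y)
    (hu : ∀ y ∈ chainComponent G u, ∀ x, E.Adj x y ↔ D.Adj x y)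
    (hvx : E.Adj v x) (hxu : x ≠ u) (h : Relation.ReflTransGen E.Adj x u) :
    ∃ y, D.Adj v y ∧ y ≠ u ∧ Relation.ReflTransGen D.Adj y u := by
  have hline : ∀ x, E.Adj v x → G.Adj x v → x ≠ u → Relation.ReflTransGen E.Adj x u →
      ∃ y, D.Adj v y ∧ y ≠ u ∧ Relation.ReflTransGen D.Adj y u := by
    intro x hvx hxv hxu h
    have hx := mem_chainComponent_of_adj (mem_chainComponent_self G v) (hE.adj hvx) hxv
    exact ⟨x, (hv x hx v).1 hvx, hxu, hD.reflTransGen_of_agree hE hv hx h⟩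
  by_cases hxv : G.Adj x v
  · exact hline x hvx hxv hxu h
  have hvx' : IsArrow G v x := ⟨hE.adj hvx, hxv⟩
  obtain ⟨y, h1, h2⟩ := hE.exists_lines_arrows h
  clear h hvx hxv
  induction h1 using Relation.ReflTransGen.head_induction_on with
  | refl => exact ⟨y, hD.adj_of_isArrow hvx', hxu, hD.reflTransGen_of_arrows h2⟩
  | head hac hcy ih =>
    rename_i a c
    by_cases hcu : c = u
    · subst hcu
      exact ⟨a, hD.adj_of_isArrow hvx', hxu,
        .single ((hu c (mem_chainComponent_self G c) a).1 hac.1)⟩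
    have hvc := hE.adj_of_isArrow_of_isLine hvx' hac.2 hac.1
    by_cases hcv : G.Adj c v
    · refine hline c hvc hcv hcu (Relation.ReflTransGen.trans ?_ (hE.reflTransGen_of_arrows h2))
      exact Relation.ReflTransGen.mono (fun _ _ h => h.1) _ _ hcy
    · exact ih hcu ⟨hE.adj hvc, hcv⟩

end Paths

end EssentialGraphs

/-! ### The same modification preserves equivalence. -/

section Steps

variable {V : Type*} {ι : Type*} {𝓘 : ι → Finset V} {G D E : Digraph V} {u v : V}

theorem IsEssentialFor.adj_and_adj_iff (hD : IsEssentialFor 𝓘 G D) (hE : IsEssentialFor 𝓘 G E)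
    {x y z : V} (hxz : x ≠ z) (hn : ¬ IsAdjacent G x z) :
    E.Adj x y ∧ E.Adj z y ↔ D.Adj x y ∧ D.Adj z y := by
  have h1 := (hE.isVStructure_iff x y z).trans (hD.isVStructure_iff x y z).symm
  have h2 := hE.isAdjacent_iff x z
  have h3 := hD.isAdjacent_iff x z
  simp only [IsVStructure] at h1
  tauto

theorem IsEssentialFor.mem_iff_of_adj (hD : IsEssentialFor 𝓘 G D) (hE : IsEssentialFor 𝓘 G E)
    {a b : V} (hab : E.Adj a b) (hba : D.Adj b a) (j : ι) : a ∈ 𝓘 j ↔ b ∈ 𝓘 j :=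
  hD.mem_iff ⟨hE.adj hab, hD.adj hba⟩ j

theorem IsEssentialFor.isAdjacent_iff' (hD : IsEssentialFor 𝓘 G D) (hE : IsEssentialFor 𝓘 G E)
    (a b : V) : IsAdjacent E a b ↔ IsAdjacent D a b :=
  (hE.isAdjacent_iff a b).symm.trans (hD.isAdjacent_iff a b)

theorem graphEquivalent_of_adj_and_adj_iff {D' E' : Digraph V}
    (hadj : ∀ a b, IsAdjacent E' a b ↔ IsAdjacent D' a b)
    (hv : ∀ x y z, x ≠ z → ¬ IsAdjacent D' x z →
      (E'.Adj x y ∧ E'.Adj z y ↔ D'.Adj x y ∧ D'.Adj z y))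
    (hI : ∀ a b, E'.Adj a b → D'.Adj b a → ∀ j, a ∈ 𝓘 j ↔ b ∈ 𝓘 j) :
    GraphEquivalent 𝓘 E' D' := by
  refine ⟨hadj, fun x y z => ?_, hI⟩
  have := hv x y z
  simp only [IsVStructure, hadj]
  tauto

theorem IsDAG.not_reflTransGen_of_addEdge (h : IsDAG (IntervGraph.addEdge D u v)) :
    ¬ Relation.ReflTransGen D.Adj v u := fun hvu =>
  h u (.head' (Or.inr ⟨rfl, rfl⟩)
    (Relation.ReflTransGen.mono (fun _ _ h' => Or.inl h') v u hvu))

/-- Only the parents of `v` change, and there `E` and `D` agree. Elsewhere, vertices that remain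
nonadjacent were nonadjacent in `G`. -/
theorem graphEquivalent_addEdge (hD : IsEssentialFor 𝓘 G D) (hE : IsEssentialFor 𝓘 G E)
    (hn : ¬ IsAdjacent G u v) (hED : ∀ x, E.Adj x v ↔ D.Adj x v) (huv : u ≠ v) :
    GraphEquivalent 𝓘 (addEdge E u v) (addEdge D u v) := by
  have hadj := hD.isAdjacent_iff' hE
  refine graphEquivalent_of_adj_and_adj_iff (fun a b => ?_) (fun x y z hxz hn' => ?_)
    fun a b hab hba => ?_
  · have := hadj a b
    simp only [IsAdjacent, addEdge] at this ⊢
    tauto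
  · have hnG : ¬ IsAdjacent G x z := by
      rw [hD.isAdjacent_iff]
      simp only [IsAdjacent, addEdge] at hn' ⊢
      tauto
    have h1 := hD.adj_and_adj_iff hE (y := y) hxz hnG
    simp only [addEdge]
    by_cases hy : y = v
    · subst hy
      simp only [hED]
    · simpa [hy] using h1
  · rw [hD.isAdjacent_iff, IsAdjacent] at hn
    have hnE := hadj u v
    simp only [IsAdjacent] at hnE
    rcases hab with hab | ⟨rfl, rfl⟩ <;> rcases hba with hba | ⟨h1, h2⟩
    · exact hD.mem_iff_of_adj hE hab hba
    · subst h1 h2; tauto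
    · tauto
    · exact absurd h1.symm huv

theorem graphEquivalent_removeEdge (hD : IsEssentialFor 𝓘 G D) (hE : IsEssentialFor 𝓘 G E)
    (hED : ∀ y ∈ chainComponent G v, ∀ x, E.Adj x y ↔ D.Adj x y) (huv : D.Adj u v) :
    GraphEquivalent 𝓘 (removeEdge E u v) (removeEdge D u v) := by
  have hadj := hD.isAdjacent_iff' hE
  have huvE : E.Adj u v := (hED v (mem_chainComponent_self G v) u).2 huv
  have hvuD := hD.isDAG.not_adj huv
  have hvuE := hE.isDAG.not_adj huvE
  refine graphEquivalent_of_adj_and_adj_iff (fun a b => ?_) (fun x y z hxz hn' => ?_)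
    fun a b hab hba => ?_
  · have := hadj a b
    simp only [IsAdjacent, removeEdge] at this ⊢
    grind
  · by_cases hy : y ∈ chainComponent G v
    · simp only [removeEdge, hED y hy]
    have hyv : y ≠ v := fun h => hy (h ▸ mem_chainComponent_self G v)
    simp only [removeEdge, hyv, and_false, not_false_eq_true, and_true]
    -- The removal makes `u` and `v` nonadjacent, so a v-structure `u → y ← v` may appear. Outside
    -- the component, an edge `v → y` is an arrow of `G`, and `u → v → y` forces the direction of
    -- any edge between `u` and `y`.
    by_cases hnG : IsAdjacent G x z
    · have harrow : G.Adj v y → IsArrow G v y := fun h =>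
        ⟨h, fun h' => hy (mem_chainComponent_of_adj (mem_chainComponent_self G v) h h')⟩
      have h1 : E.Adj v y ↔ D.Adj v y :=
        ⟨fun h => hD.adj_of_isArrow (harrow (hE.adj h)),
          fun h => hE.adj_of_isArrow (harrow (hD.adj h))⟩
      have h2 : E.Adj v y → (E.Adj u y ↔ D.Adj u y) := by
        intro hvy
        have h3 := hE.isDAG.not_adj_of_adj_of_adj huvE hvy
        have h4 := hD.isDAG.not_adj_of_adj_of_adj huv (h1.1 hvy)
        have := hadj u y
        simp only [IsAdjacent] at this
        tauto
      rw [hD.isAdjacent_iff] at hnG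
      have h5 : (x = u ∧ z = v) ∨ (x = v ∧ z = u) := by
        simp only [IsAdjacent, removeEdge] at hnG hn'
        grind
      rcases h5 with ⟨rfl, rfl⟩ | ⟨rfl, rfl⟩ <;> tauto
    · exact hD.adj_and_adj_iff hE hxz hnG
  · exact hD.mem_iff_of_adj hE hab.1 hba.1

theorem graphEquivalent_turnEdge (hD : IsEssentialFor 𝓘 G D) (hE : IsEssentialFor 𝓘 G E)
    (hEDv : ∀ x, E.Adj x v ↔ D.Adj x v) (hEDu : ∀ x, E.Adj x u ↔ D.Adj x u) (hvu : D.Adj v u) :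
    GraphEquivalent 𝓘 (turnEdge E v u) (turnEdge D v u) := by
  have hvuE : E.Adj v u := (hEDu v).2 hvu
  have hadj := hD.isAdjacent_iff' hE
  refine graphEquivalent_of_adj_and_adj_iff (fun a b => ?_) (fun x y z hxz hn' => ?_)
    fun a b hab hba => ?_
  · rw [isAdjacent_turnEdge_iff hvuE, isAdjacent_turnEdge_iff hvu, hadj]
  · rw [isAdjacent_turnEdge_iff hvu, ← hD.isAdjacent_iff] at hn'
    have h1 := hD.adj_and_adj_iff hE (y := y) hxz hn'
    simp only [turnEdge_adj]
    by_cases hyv : y = v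
    · subst hyv
      simp only [hEDv]
    by_cases hyu : y = u
    · subst hyu
      simp only [hEDu]
    · simpa [hyv, hyu] using h1
  · rcases hab with hab | ⟨rfl, rfl⟩ <;> rcases hba with hba | ⟨h1, h2⟩
    · exact hD.mem_iff_of_adj hE hab.1 hba.1
    · subst h1 h2; exact absurd ⟨rfl, rfl⟩ hab.2
    · exact absurd ⟨rfl, rfl⟩ hba.2
    · subst h1; exact fun _ => Iff.rfl

/-- A cycle after turning in `E` gives a path from `v` to `u` not starting with `v → u`. In `D` the
corresponding path cannot return to `v`, so it avoids the turned edge altogether. -/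
theorem isDAG_turnEdge_of_agree (hD : IsEssentialFor 𝓘 G D) (hE : IsEssentialFor 𝓘 G E)
    (hv : ∀ y ∈ chainComponent G v, ∀ x, E.Adj x y ↔ D.Adj x y)
    (hu : ∀ y ∈ chainComponent G u, ∀ x, E.Adj x y ↔ D.Adj x y)
    (hvu : D.Adj v u) (hD' : IsDAG (turnEdge D v u)) : IsDAG (turnEdge E v u) := by
  refine (hE.isDAG.of_le (removeEdge_le E v u)).addEdge fun hp => ?_
  rcases Relation.ReflTransGen.cases_head hp with rfl | ⟨x, hvx, hxu⟩
  · exact hD.isDAG.ne hvu rfl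
  have hxne : x ≠ u := fun h => hvx.2 ⟨rfl, h⟩
  obtain ⟨y, hvy, hyu, hpath⟩ := hD.exists_path_of_agree hE hv hu hvx.1 hxne
    (Relation.ReflTransGen.mono (fun _ _ h => h.1) x u hxu)
  refine IsDAG.not_reflTransGen_of_addEdge hD' (.head ⟨hvy, fun h => hyu h.2⟩ ?_)
  have key : ∀ w, Relation.ReflTransGen D.Adj y w →
      Relation.ReflTransGen (removeEdge D v u).Adj y w := by
    intro w h
    induction h with
    | refl => exact .refl
    | tail h h' ih =>
      refine ih.tail ⟨h', fun e => ?_⟩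
      exact hD.isDAG v (.head' hvy (e.1 ▸ h))
  exact key u hpath

variable [Fintype V] [DecidableEq V] {Ω : V → Type*} [∀ i, MeasurableSpace (Ω i)]
  {μ : ∀ i, Measure (Ω i)} [∀ i, SigmaFinite (μ i)]

theorem isPartialEssentialGraph_of_graphEquivalent (hμ : ∀ i, μ i ≠ 0) {D H : Digraph V}
    (hD : IsDAG D) (hDH : ∀ a b, D.Adj a b → H.Adj a b)
    (hH : ∀ a b, H.Adj a b → ¬ D.Adj a b →
      ∃ E, IsDAG E ∧ GraphEquivalent 𝓘 E D ∧ E.Adj a b)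
    (hind : ∀ a b c, IsArrow H a b → IsLine H b c → IsAdjacent H a c) :
    IsPartialEssentialGraph μ 𝓘 D H := by
  refine ⟨hD, fun a b h => hDH a b h, fun a b h => ?_,
    fun ⟨a, b, c, h1, h2, h3⟩ => h3 (hind a b c h1 h2)⟩
  rw [essentialGraph, Digraph.sSup_adj]
  by_cases hab : D.Adj a b
  · exact ⟨D, ⟨hD, rfl⟩, hab⟩
  · obtain ⟨E, h1, h2, h3⟩ := hH a b h hab
    exact ⟨E, ⟨h1, markovEquivalent_of_graphEquivalent hμ h1 hD h2⟩, h3⟩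

theorem IsEssentialGraph.exists_isEssentialFor
    (hμ : ∀ i, ∃ A B : Set (Ω i), MeasurableSet A ∧ MeasurableSet B ∧ Disjoint A B ∧
      0 < μ i A ∧ 0 < μ i B) (h𝓘 : IsConservative 𝓘) (hG : IsEssentialGraph μ 𝓘 G) :
    ∃ D, IsEssentialFor 𝓘 G D := by
  have hμ' : ∀ i, μ i ≠ 0 := fun i h => by
    obtain ⟨A, _, _, _, _, hA, _⟩ := hμ i
    simp [h] at hA
  obtain ⟨D, hD, rfl⟩ := hG
  refine ⟨D, hD, fun a b => ?_⟩
  rw [essentialGraph, Digraph.sSup_adj]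
  exact ⟨fun ⟨D', h, hab⟩ =>
      ⟨D', h.1, graphEquivalent_of_markovEquivalent hμ h𝓘 h.1 hD h.2, hab⟩,
    fun ⟨D', h, h', hab⟩ => ⟨D', ⟨h, markovEquivalent_of_graphEquivalent hμ' h hD h'⟩, hab⟩⟩

end Steps

/-! ### The three modifications yield partial essential graphs. -/

section PartialEssentialGraphs

variable {V : Type*} {ι : Type*} {𝓘 : ι → Finset V} {G D : Digraph V} {u v : V}

theorem IsEssentialFor.orientAs_adj_of_adj (hD : IsEssentialFor 𝓘 G D) (T : Set V) {a b : V}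
    (h : D.Adj a b) : (IntervGraph.orientAs G D T).Adj a b := by
  have := hD.adj h
  simp only [IntervGraph.orientAs]
  tauto

theorem IsEssentialFor.adj_of_orientAs (hD : IsEssentialFor 𝓘 G D) {T : Set V} {a b : V}
    (h : (IntervGraph.orientAs G D T).Adj a b) : G.Adj a b :=
  adj_of_orientAs_adj (fun _ _ => hD.adj) (fun _ _ h => h) h

/-- The lines that remain after orienting a chain component lie outside of it. -/
theorem IsEssentialFor.isLine_orientAs (hD : IsEssentialFor 𝓘 G D) {b c : V}
    (h : IsLine (IntervGraph.orientAs G D (chainComponent G v)) b c) :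
    IsLine G b c ∧ b ∉ chainComponent G v ∧ c ∉ chainComponent G v := by
  have hG : IsLine G b c := ⟨hD.adj_of_orientAs h.1, hD.adj_of_orientAs h.2⟩
  have hbc := hG.mem_chainComponent_iff (v := v)
  refine ⟨hG, ?_⟩
  by_contra hn
  have hb : b ∈ chainComponent G v := by tauto
  have h1 : D.Adj b c := h.1.elim (fun h' => h'.2.2) fun h' => absurd ⟨hb, hbc.1 hb⟩ h'.1
  have h2 : D.Adj c b := h.2.elim (fun h' => h'.2.2) fun h' => absurd ⟨hbc.1 hb, hb⟩ h'.1
  exact hD.isDAG.not_adj h1 h2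

theorem IsEssentialFor.orientAs_adj_of_notMem {T : Set V} {a b : V} (h : a ∉ T ∨ b ∉ T) :
    (IntervGraph.orientAs G D T).Adj a b ↔ G.Adj a b := by
  simp only [IntervGraph.orientAs]
  tauto

variable [Fintype V] [DecidableEq V] {Ω : V → Type*} [∀ i, MeasurableSpace (Ω i)]
  {μ : ∀ i, Measure (Ω i)} [∀ i, SigmaFinite (μ i)]

theorem isPartialEssentialGraph_addEdge (hμ : ∀ i, μ i ≠ 0) (hD : IsEssentialFor 𝓘 G D)
    (huv : u ≠ v) (hn : ¬ IsAdjacent G u v) (hD' : IsDAG (addEdge D u v)) :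
    IsPartialEssentialGraph μ 𝓘 (addEdge D u v)
      (addEdge (orientAs G D (chainComponent G v)) u v) := by
  have hv := mem_chainComponent_self G v
  refine isPartialEssentialGraph_of_graphEquivalent hμ hD' ?_ ?_ ?_
  · exact fun a b h => h.imp_left (hD.orientAs_adj_of_adj _)
  · rintro a b ((⟨ha, hb, h⟩ | ⟨hab, h⟩) | h) hnD
    · exact absurd (.inl h) hnD
    · obtain ⟨E, hE, hEab, hED⟩ := hD.exists_reorientation v v h hab hab
      refine ⟨addEdge E u v, hE.isDAG.addEdge fun hp => ?_, ?_, .inl hEab⟩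
      · exact IsDAG.not_reflTransGen_of_addEdge hD'
          (hD.reflTransGen_of_agree hE (fun y hy => hED y (.inl hy)) hv hp)
      · exact graphEquivalent_addEdge hD hE hn (hED v (.inl hv)) huv
    · exact absurd (.inr h) hnD
  · intro a b c hab hbc
    have hbc' : IsLine (orientAs G D (chainComponent G v)) b c := by
      rcases hbc with ⟨h1 | ⟨rfl, rfl⟩, h2 | ⟨h3, h4⟩⟩
      · exact ⟨h1, h2⟩
      · subst h3 h4
        exact absurd (.inr (hD.adj_of_orientAs h1)) hn
      · exact absurd (.inr (hD.adj_of_orientAs h2)) hn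
      · exact absurd h3.symm huv
    obtain ⟨hG, hb, hc⟩ := hD.isLine_orientAs hbc'
    have hbv : b ≠ v := fun h => hb (h ▸ hv)
    have hab' : IsArrow G a b := by
      refine ⟨(hab.1.resolve_right fun h => hbv h.2) |> hD.adj_of_orientAs, fun h => hab.2 ?_⟩
      exact .inl ((IsEssentialFor.orientAs_adj_of_notMem (.inl hb)).2 h)
    have h := hD.isAdjacent_of_isArrow_of_isLine hab' hG
    exact h.imp (fun h => .inl ((IsEssentialFor.orientAs_adj_of_notMem (.inr hc)).2 h))
      fun h => .inl ((IsEssentialFor.orientAs_adj_of_notMem (.inl hc)).2 h)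

theorem isPartialEssentialGraph_removeEdge (hμ : ∀ i, μ i ≠ 0) (hD : IsEssentialFor 𝓘 G D)
    (huv : D.Adj u v) :
    IsPartialEssentialGraph μ 𝓘 (removeEdge D u v)
      (removeEdge (orientAs G D (chainComponent G v)) u v) := by
  have hv := mem_chainComponent_self G v
  refine isPartialEssentialGraph_of_graphEquivalent hμ (hD.isDAG.of_le (removeEdge_le D u v))
    ?_ ?_ ?_
  · exact fun a b h => ⟨hD.orientAs_adj_of_adj _ h.1, h.2⟩
  · rintro a b ⟨⟨ha, hb, h⟩ | ⟨hab, h⟩, hne⟩ hnD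
    · exact absurd ⟨h, hne⟩ hnD
    · obtain ⟨E, hE, hEab, hED⟩ := hD.exists_reorientation v v h hab hab
      exact ⟨removeEdge E u v, hE.isDAG.of_le (removeEdge_le E u v),
        graphEquivalent_removeEdge hD hE (fun y hy => hED y (.inl hy)) huv, hEab, hne⟩
  · intro a b c hab hbc
    obtain ⟨hG, hb, hc⟩ := hD.isLine_orientAs ⟨hbc.1.1, hbc.2.1⟩
    have hcv : c ≠ v := fun h => hc (h ▸ hv)
    have hab' : IsArrow G a b := by
      refine ⟨hD.adj_of_orientAs hab.1.1, fun h => hab.2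
        ⟨(IsEssentialFor.orientAs_adj_of_notMem (.inl hb)).2 h, ?_⟩⟩
      rintro ⟨rfl, rfl⟩
      exact hb (mem_chainComponent_of_adj hv (hD.adj_of_orientAs hab.1.1) h)
    rcases hD.isAdjacent_of_isArrow_of_isLine hab' hG with h | h
    · exact .inl ⟨(IsEssentialFor.orientAs_adj_of_notMem (.inr hc)).2 h, fun e => hcv e.2⟩
    · refine .inr ⟨(IsEssentialFor.orientAs_adj_of_notMem (.inl hc)).2 h, ?_⟩
      rintro ⟨rfl, rfl⟩
      -- The removed edge was the adjacency between `c = u` and `a = v`. Both `u → v` and `v → b`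
      -- are arrows of `G`, so a member orienting the line as `b → u` has a directed triangle.
      obtain ⟨E, hE, -, hbc'⟩ := hD.exists_adj hG.1
      have hca : IsArrow G c a := ⟨h, fun h' => hc (mem_chainComponent_of_adj hv h' h)⟩
      exact hE.isDAG.not_adj_of_adj_of_adj (hE.adj_of_isArrow hca) (hE.adj_of_isArrow hab') hbc'

/-- Keeping `H` abstract covers both turning steps: it agrees with `D` inside the components of `v`
and `u` and with `G` elsewhere, whether or not they coincide. -/
theorem isPartialEssentialGraph_turnEdge (hμ : ∀ i, μ i ≠ 0) (hD : IsEssentialFor 𝓘 G D)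
    (hvu : D.Adj v u) (hD' : IsDAG (turnEdge D v u)) {H : Digraph V}
    (hDH : ∀ a b, D.Adj a b → H.Adj a b) (hHG : ∀ a b, H.Adj a b → G.Adj a b)
    (hHD : ∀ a b, (a ∈ chainComponent G v ∧ b ∈ chainComponent G v) ∨
      (a ∈ chainComponent G u ∧ b ∈ chainComponent G u) → H.Adj a b → D.Adj a b)
    (hGH : ∀ a b, ¬ ((a ∈ chainComponent G v ∧ b ∈ chainComponent G v) ∨
      (a ∈ chainComponent G u ∧ b ∈ chainComponent G u)) → G.Adj a b → H.Adj a b)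
    (hHuv : ¬ H.Adj u v) :
    IsPartialEssentialGraph μ 𝓘 (turnEdge D v u) (turnEdge H v u) := by
  have hv := mem_chainComponent_self G v
  have hu := mem_chainComponent_self G u
  have hne := hD.isDAG.ne hvu
  refine isPartialEssentialGraph_of_graphEquivalent hμ hD' ?_ ?_ ?_
  · exact fun a b h => h.imp_left fun h => ⟨hDH a b h.1, h.2⟩
  · rintro a b (⟨h, hab⟩ | h) hnD
    · by_cases hm : (a ∈ chainComponent G v ∧ b ∈ chainComponent G v) ∨
        (a ∈ chainComponent G u ∧ b ∈ chainComponent G u)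
      · exact absurd (.inl ⟨hHD a b hm h, hab⟩) hnD
      obtain ⟨E, hE, hEab, hED⟩ := hD.exists_reorientation v u (hHG a b h)
        (fun h => hm (.inl h)) fun h => hm (.inr h)
      have hEDv := fun y hy => hED y (.inl hy)
      have hEDu := fun y hy => hED y (.inr hy)
      exact ⟨turnEdge E v u, isDAG_turnEdge_of_agree hD hE hEDv hEDu hvu hD',
        graphEquivalent_turnEdge hD hE (hEDv v hv) (hEDu u hu) hvu, .inl ⟨hEab, hab⟩⟩
    · exact absurd (.inr h) hnD
  · intro a b c hab hbc
    have hbc' : IsLine H b c := by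
      rcases hbc with ⟨h1 | ⟨rfl, rfl⟩, h2 | ⟨h3, h4⟩⟩
      · exact ⟨h1.1, h2.1⟩
      · subst h3 h4; exact absurd ⟨rfl, rfl⟩ h1.2
      · exact absurd ⟨rfl, rfl⟩ h2.2
      · exact absurd h3 hne
    have hG : IsLine G b c := ⟨hHG _ _ hbc'.1, hHG _ _ hbc'.2⟩
    have hbc₁ := hG.mem_chainComponent_iff (v := v)
    have hbc₂ := hG.mem_chainComponent_iff (v := u)
    have hout : b ∉ chainComponent G v ∧ b ∉ chainComponent G u := by
      by_contra hn
      refine hD.isDAG.not_adj (hHD b c ?_ hbc'.1) (hHD c b ?_ hbc'.2) <;> tauto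
    have hbv : b ≠ v := fun h => hout.1 (h ▸ hv)
    have hbu : b ≠ u := fun h => hout.2 (h ▸ hu)
    have hcv : c ≠ v := fun h => hout.1 (hbc₁.2 (h ▸ hv))
    have hcu : c ≠ u := fun h => hout.2 (hbc₂.2 (h ▸ hu))
    have hab' : IsArrow G a b := by
      refine ⟨hHG _ _ (hab.1.resolve_right fun h => hbv h.2).1, fun h => hab.2 (.inl ⟨?_, ?_⟩)⟩
      · exact hGH b a (by tauto) h
      · exact fun h => hbv h.1
    exact (hD.isAdjacent_of_isArrow_of_isLine hab' hG).imp
      (fun h => .inl ⟨hGH a c (by tauto) h, fun e => hcu e.2⟩)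
      fun h => .inl ⟨hGH c a (by tauto) h, fun e => hcv e.1⟩

end PartialEssentialGraphs

end IntervGraph

open IntervGraph
theorem mainTheorem10 {p : ℕ} {Ω : Fin p → Type*} [∀ i, MeasurableSpace (Ω i)]
    (μ : ∀ i, Measure (Ω i)) [∀ i, SigmaFinite (μ i)]
    (hμ : ∀ i, ∃ A B : Set (Ω i), MeasurableSet A ∧ MeasurableSet B ∧ Disjoint A B ∧
      0 < μ i A ∧ 0 < μ i B)
    {J : ℕ} (𝓘 : Fin J → Finset (Fin p)) (h𝓘 : IsConservative 𝓘)
    (G : Digraph (Fin p)) (hG : IsEssentialGraph μ 𝓘 G) :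
    -- forward step
    (∀ (u v : Fin p) (C : Set (Fin p)) (D D' : Digraph (Fin p)),
      u ≠ v → ¬ IsAdjacent G u v → D ∈ representatives G →
      {a ∈ nb G v | IsArrow D a v} = C →
      D' = addEdge D u v → D' ∈ forwardDAGs G →
      IsPartialEssentialGraph μ 𝓘 D'
        (addEdge (orientAs G D (chainComponent G v)) u v)) ∧
    -- backward step
    (∀ (u v : Fin p) (C : Set (Fin p)) (D D' : Digraph (Fin p)),
      G.Adj u v → D ∈ representatives G → IsArrow D u v →
      {a ∈ nb G v \ {u} | IsArrow D a v} = C →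
      D' = removeEdge D u v → D' ∈ backwardDAGs G →
      IsPartialEssentialGraph μ 𝓘 D'
        (removeEdge (orientAs G D (chainComponent G v)) u v)) ∧
    -- turning step, the edge is a line of `G`
    (∀ (u v : Fin p) (C : Set (Fin p)) (D D' : Digraph (Fin p)),
      IsLine G u v → C ⊆ nb G v \ {u} → D ∈ representatives G → IsArrow D v u →
      {a ∈ nb G v | IsArrow D a v} = C →
      D' = addEdge (removeEdge D v u) u v → D' ∈ turningDAGs G →
      IsPartialEssentialGraph μ 𝓘 D'
        (addEdge (removeEdge (orientAs G D (chainComponent G v)) v u) u v)) ∧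
    -- turning step, the edge is an arrow of `G`
    (∀ (u v : Fin p) (C : Set (Fin p)) (D D' : Digraph (Fin p)),
      IsArrow G v u → D ∈ representatives G →
      {a ∈ nb G v | IsArrow D a v} = C →
      D' = addEdge (removeEdge D v u) u v → D' ∈ turningDAGs G →
      IsPartialEssentialGraph μ 𝓘 D'
        (addEdge (removeEdge (orientAs (orientAs G D (chainComponent G v)) D
          (chainComponent G u)) v u) u v)) := by
  have hμ' : ∀ i, μ i ≠ 0 := fun i h => by
    obtain ⟨A, _, _, _, _, hA, _⟩ := hμ i
    simp [h] at hA
  obtain ⟨D₀, hD₀⟩ := hG.exists_isEssentialFor hμ h𝓘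
  refine ⟨?_, ?_, ?_, ?_⟩
  · rintro u v C D D' huv hn hD - rfl hD'
    exact isPartialEssentialGraph_addEdge hμ' (hD₀.of_mem_representatives hD) huv hn hD'.1
  · rintro u v C D D' - hD huv - rfl -
    exact isPartialEssentialGraph_removeEdge hμ' (hD₀.of_mem_representatives hD) huv.1
  · rintro u v C D D' huv - hD hvu - rfl hD'
    have hD₁ := hD₀.of_mem_representatives hD
    have hv := mem_chainComponent_self G v
    have hu : u ∈ chainComponent G v := huv.mem_chainComponent_iff.2 hv
    -- The ends of a line share their chain component, so orienting one component serves both.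
    have hT : chainComponent G u = chainComponent G v := Set.ext fun x =>
      ⟨fun h => ⟨hu.1.trans h.1, h.2.trans hu.2⟩, fun h => ⟨hu.2.trans h.1, h.2.trans hu.1⟩⟩
    refine isPartialEssentialGraph_turnEdge hμ' hD₁ hvu.1 hD'.1
      (fun a b => hD₁.orientAs_adj_of_adj _) (fun a b => hD₁.adj_of_orientAs) ?_ ?_ ?_
    · rw [hT]
      simp only [orientAs]
      tauto
    · rw [hT]
      simp only [orientAs]
      tauto
    · have := hvu.2
      simp only [orientAs]
      tauto
  · rintro u v C D D' hvu hD - rfl hD'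
    have hD₁ := hD₀.of_mem_representatives hD
    have hle : ∀ a b, D.Adj a b → G.Adj a b := fun _ _ => hD₁.adj
    refine isPartialEssentialGraph_turnEdge hμ' hD₁ (hD₁.adj_of_isArrow hvu) hD'.1 ?_ ?_ ?_ ?_ ?_
    · intro a b h
      have := hle a b h
      simp only [orientAs]
      tauto
    · intro a b h
      have := hle a b
      simp only [orientAs] at h
      tauto
    · simp only [orientAs]
      tauto
    · simp only [orientAs]
      tauto
    · intro h
      have := hle u v
      have := hvu.2
      simp only [orientAs] at h
      tauto
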